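/- Let $T=(V,E)$ be a finite tree. A path in $T$ is a sequence of distinct vertices $v_0v_1\cdots v_l$ ($l\ge 0$), consecutive ones being adjacent; it contains the vertices $v_i$. A family $\mathcal F$ of paths of $T$ separates $V$ if for any two distinct vertices some path of $\mathcal F$ contains exactly one of them, and covers $V$ if every vertex is contained in some path of $\mathcal F$. Let $\operatorname{sp}_C(T,V)$ be the minimum size of a family of paths of $T$ that separates and covers $V$. Let $h_1(T)$ be the number of leaves (vertices of degree $1$) of $T$. A bare path of $T$ is a path with at least one edge whose two extremes have degree different from $2$ and whose other vertices all have degree $2$ (paths are taken here without orientation); let $\mathcal P$ be the set of all bare paths (they partition $E$), let $\mathcal I\subseteq\mathcal P$ be the set of those that contain no leaf and have at least two edges, and put $$h_2^*(T)=\sum_{P\in\mathcal P\setminus\mathcal I}(|E(P)|-1)+\sum_{P\in\mathcal I}(|E(P)|-2),$$ that is, the number of vertices of degree $2$ minus $|\mathcal I|$. An edge is interior if neither of its endpoints is a leaf. A bunch of leaves is a connected component, other than an isolated vertex, of the graph obtained from $T$ by deleting all interior edges; its size is the number of leaves of $T$ that it contains. Then $$\operatorname{sp}_C(T,V)\ \ge\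 \max\left\{\left\lceil\frac{2h_1(T)+h_2^*(T)}{3}\right\rceil,\ \left\lceil\frac{h_1(T)+h_2^*(T)}{2}\right\rceil\right\}.$$ If moreover all bunches of $T$ have size at least $3$ and $T$ is not (isomorphic to) the star $K_{1,3}$, then $$\operatorname{sp}_C(T,V)\ \le\ \left\lceil\frac{2h_1(T)}{3}\right\rceil+\left\lceil\frac{h_2^*(T)+1}{2}\right\rceil.$$ -/

import Mathlib

namespace PathSeparation

open SimpleGraph

variable {V : Type*}

/-- The elements (vertices and edges) of a graph. -/
abbrev Elem (G : SimpleGraph V) : Type _ := V ⊕ G.edgeSet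

/-- A path of `G` with arbitrary extremes: a sequence of distinct, consecutively adjacent vertices.
Paths of length zero (a single vertex) are allowed. -/
abbrev AnyPath (G : SimpleGraph V) : Type _ := Σ u v : V, G.Path u v

/-- The path `P` contains the vertex or edge `s`. -/
def Contains {G : SimpleGraph V} (P : AnyPath G) : Elem G → Prop
  | Sum.inl v => v ∈ P.2.2.1.support
  | Sum.inr e => (e : Sym2 V) ∈ P.2.2.1.edges

/-- The family `F` of paths separates the set `S` of elements. -/
def Separates {G : SimpleGraph V} (F : Finset (AnyPath G)) (S : Set (Elem G)) : Prop :=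
  ∀ s ∈ S, ∀ t ∈ S, s ≠ t →
    ∃ P ∈ F, (Contains P s ∧ ¬ Contains P t) ∨ (¬ Contains P s ∧ Contains P t)

/-- The family `F` of paths covers the set `S` of elements. -/
def Covers {G : SimpleGraph V} (F : Finset (AnyPath G)) (S : Set (Elem G)) : Prop :=
  ∀ s ∈ S, ∃ P ∈ F, Contains P s

/-- The minimum size of a family of paths of `G` that separates and covers `S`. -/
noncomputable def spathC (G : SimpleGraph V) (S : Set (Elem G)) : ℕ :=
  sInf {k | ∃ F : Finset (AnyPath G), Separates F S ∧ Covers F S ∧ F.card = k}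

/-- The set of all vertices of `G`, as a set of elements. -/
def vertexElems (G : SimpleGraph V) : Set (Elem G) := Set.range Sum.inl

/-- In a finite graph every set of elements has a separating-covering system, so the minimum
defining `spathC` is attained. -/
theorem spathC_attained [Finite V] (G : SimpleGraph V) (S : Set (Elem G)) :
    ∃ F : Finset (AnyPath G), Separates F S ∧ Covers F S ∧ F.card = spathC G S := by
  classical
  have hne : {k | ∃ F : Finset (AnyPath G), Separates F S ∧ Covers F S ∧ F.card = k}.Nonempty := by
    have := Fintype.ofFinite V
    have key : ∀ s : Elem G, ∃ P : AnyPath G, Contains P s ∧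
        (∀ t : Elem G, Contains P t → t = s ∨ (s.isRight ∧ t.isLeft)) := by
      rintro (v | ⟨e, he⟩)
      · refine ⟨⟨v, v, Path.nil⟩, by simp [Contains], ?_⟩
        rintro (w | e) h
        · left; simpa [Contains] using h
        · simp [Contains] at h
      · induction e with
        | _ a b =>
          have hab : G.Adj a b := he
          refine ⟨⟨a, b, Path.singleton hab⟩, by simp [Contains, Path.singleton], ?_⟩
          rintro (w | ⟨f, hf⟩) h
          · right; simp
          · left
            have : f = s(a, b) := by simpa [Contains, Path.singleton] using h
            subst this; rfl
    choose P hP hP' using key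
    refine ⟨_, Finset.univ.image P, ?_, ?_, rfl⟩
    · intro s _ t _ hst
      by_cases h : Contains (P s) t
      · refine ⟨P t, by simp, Or.inr ⟨?_, hP t⟩⟩
        intro h'
        rcases hP' _ _ h with h1 | ⟨h1, h2⟩
        · exact hst h1.symm
        · rcases hP' _ _ h' with h3 | ⟨h3, h4⟩
          · exact hst h3
          · cases t <;> simp_all
      · exact ⟨P s, by simp, Or.inl ⟨hP s, h⟩⟩
    · intro s _
      exact ⟨P s, by simp, hP s⟩
  exact Nat.sInf_mem hne

section Trees

variable (G : SimpleGraph V) [G.LocallyFinite]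

/-- The number of leaves. -/
noncomputable def h1 : ℕ := {v : V | G.degree v = 1}.ncard

/-- The interior edges: those with no leaf among their endpoints. -/
def interiorEdges : Set (Sym2 V) := {e ∈ G.edgeSet | ∀ v ∈ e, G.degree v ≠ 1}

/-- The graph obtained by deleting all interior edges. -/
def leafGraph : SimpleGraph V := G.deleteEdges (interiorEdges G)

/-- A bunch of leaves: a component, other than an isolated vertex, of the graph obtained by
deleting all interior edges. -/
def IsBunch (c : (leafGraph G).ConnectedComponent) : Prop := c.supp.Nontrivial

/-- The size of a bunch: the number of leaves (of `G`) that it contains. -/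
noncomputable def bunchSize (c : (leafGraph G).ConnectedComponent) : ℕ :=
  {v ∈ c.supp | G.degree v = 1}.ncard

/-- The bare paths of `G`, as undirected paths (subgraphs): paths with at least one edge whose two
extremes have degree different from two, and whose other vertices all have degree two. -/
def barePaths : Set G.Subgraph :=
  {H | ∃ (u v : V) (p : G.Walk u v), p.IsPath ∧ u ≠ v ∧ G.degree u ≠ 2 ∧ G.degree v ≠ 2 ∧
    (∀ w ∈ p.support, w ≠ u → w ≠ v → G.degree w = 2) ∧ H = p.toSubgraph}

/-- The bare paths that contain no leaf and have at least two edges. -/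
def leaflessLong : Set G.Subgraph :=
  {H ∈ barePaths G | (∀ w ∈ H.verts, G.degree w ≠ 1) ∧ 2 ≤ H.edgeSet.ncard}

/-- The parameter `h₂*`. (For finite graphs the sums are finite and no subtraction truncates.) -/
noncomputable def h2star : ℕ :=
  (∑ᶠ H ∈ barePaths G \ leaflessLong G, (H.edgeSet.ncard - 1)) +
    ∑ᶠ H ∈ leaflessLong G, (H.edgeSet.ncard - 2)

end Trees

end PathSeparation

/-!
The lower bound is a count of path ends. Call an edge *low* if both endpoints have degree at most
two. Bare paths are edge-disjoint, and each of them has enough low edges to give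
`h2star T ≤ #low edges`. Every low edge is cut by some path of the family (its endpoints are
separated), and every leaf lies on some path. A path has at most two such incidences, one for each
extreme (`card_leaves_add_card_cut_le`), hence `h1 + h2star ≤ 2 k`. A path contains at most one leaf
that lies on no other path, so all but `k` leaves are counted twice, and
`2 h1 + h2star ≤ 3 k` (`counting_bounds`).

For the upper bound, root the tree at a leaf and number the vertices in depth-first preorder, so
that the descendants of each vertex form an interval. The size condition on bunches means that each
vertex `s` adjacent to a leaf (a support vertex) has three leaves `a s`, `b s`, `c s`. Arrange the
support vertices cyclically in preorder, with successor `nx`, and take the paths joining `a s` to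
`b s` and `b s` to `c (nx s)`; group the other leaves in triples `x, y, z`, with paths `x y` and
`y z`. This takes at most `⌈2 h1 / 3⌉` paths, which separate the leaves. On both sides of an inner
edge the support vertices form an interval of the cyclic order. Therefore each vertex of degree at
least three has a path through it that avoids any given branch (`separates_three_le`), and each
vertex of degree two lies on two paths that cross it in opposite directions. The consequence is
that only vertices of degree two on the same bare path can remain unseparated
(`separates_leaf_degree_two`, `separates_degree_two`). Here at least two support vertices are
assumed; with one, the tree is a star and the trivial path at its centre is added.

Finally let `M` be the number of edges joining two vertices of degree two; `M ≤ h2star T`. Number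
these edges in preorder, so that those inside a bare path are consecutive, pair them at distance
`M / 2 + 1`, and join the two edges of each pair by the path between them (an edge without partner
is joined to the root). No nonempty interval of the edges is closed under this pairing
(`exists_unpaired`), so these `M / 2 + 1` paths separate the vertices inside each bare path
(`exists_pairs_separating_chains`).
-/

namespace PathSeparation

open SimpleGraph

/-! ### Rooted trees and the depth-first preorder -/

section Rooted

variable {V : Type*} {T : SimpleGraph V}

/-- The vertex `w` lies on a path from `u` to `v`; in a tree, on the unique one. -/
def OnPath (T : SimpleGraph V) (u v w : V) : Prop :=
  ∃ p : T.Walk u v, p.IsPath ∧ w ∈ p.support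

/-- In the tree rooted at `r`, the vertex `y` is an ancestor of `w` (possibly `w` itself). -/
def Anc (T : SimpleGraph V) (r y w : V) : Prop := OnPath T r w y

/-- In the tree rooted at `r`, the vertex `x` is the parent of `y`. -/
def Par (T : SimpleGraph V) (r x y : V) : Prop := T.Adj x y ∧ Anc T r x y

lemma onPath_iff (hT : T.IsTree) {u v w : V} {p : T.Walk u v} (hp : p.IsPath) :
    OnPath T u v w ↔ w ∈ p.support := by
  refine ⟨?_, fun h => ⟨p, hp, h⟩⟩
  rintro ⟨q, hq, h⟩
  rwa [(hT.existsUnique_path u v).unique hp hq]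

lemma exists_isPath (hT : T.IsTree) (u v : V) : ∃ p : T.Walk u v, p.IsPath :=
  (hT.existsUnique_path u v).exists

lemma onPath_left (hT : T.IsTree) (u v : V) : OnPath T u v u := by
  obtain ⟨p, hp⟩ := exists_isPath hT u v
  exact ⟨p, hp, p.start_mem_support⟩

lemma onPath_right (hT : T.IsTree) (u v : V) : OnPath T u v v := by
  obtain ⟨p, hp⟩ := exists_isPath hT u v
  exact ⟨p, hp, p.end_mem_support⟩

lemma OnPath.symm {u v w : V} (h : OnPath T u v w) : OnPath T v u w := by
  obtain ⟨p, hp, hw⟩ := h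
  exact ⟨p.reverse, hp.reverse, by simpa using hw⟩

variable {r : V}

lemma anc_refl (hT : T.IsTree) (y : V) : Anc T r y y := onPath_right hT r y

lemma anc_root (hT : T.IsTree) (y : V) : Anc T r r y := onPath_left hT r y

lemma Anc.trans (hT : T.IsTree) {x y z : V} (h1 : Anc T r x y) (h2 : Anc T r y z) :
    Anc T r x z := by
  classical
  obtain ⟨p, hp, hy⟩ := h2
  exact ⟨p, hp, p.support_takeUntil_subset_support hy
    ((onPath_iff hT (hp.takeUntil hy)).1 h1)⟩

lemma Anc.antisymm (hT : T.IsTree) {x y : V} (h1 : Anc T r x y) (h2 : Anc T r y x) : x = y := by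
  classical
  obtain ⟨p, hp, hx⟩ := h1
  by_contra hne
  exact (Walk.endpoint_notMem_support_takeUntil hp hx (Ne.symm hne))
    ((onPath_iff hT (hp.takeUntil hx)).1 h2)

/-- The ancestors of a vertex form a chain. -/
lemma Anc.total (hT : T.IsTree) {x y w : V} (h1 : Anc T r x w) (h2 : Anc T r y w) :
    Anc T r x y ∨ Anc T r y x := by
  classical
  obtain ⟨p, hp, hx⟩ := h1
  have hy : y ∈ p.support := (onPath_iff hT hp).1 h2
  rw [← p.take_spec hx, Walk.mem_support_append_iff] at hy
  rcases hy with hy | hy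
  · exact Or.inr ⟨_, hp.takeUntil hx, hy⟩
  · left
    refine ⟨(p.takeUntil x hx).append ((p.dropUntil x hx).takeUntil y hy), ?_, by simp⟩
    have h3 : (((p.takeUntil x hx).append ((p.dropUntil x hx).takeUntil y hy)).append
        ((p.dropUntil x hx).dropUntil y hy)).IsPath := by
      rw [← Walk.append_assoc, Walk.take_spec, Walk.take_spec]; exact hp
    exact h3.of_append_left

lemma par_or_par (hT : T.IsTree) {x y : V} (h : T.Adj x y) : Par T r x y ∨ Par T r y x := by
  obtain ⟨p, hp⟩ := exists_isPath hT r x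
  by_cases hy : y ∈ p.support
  · exact Or.inr ⟨h.symm, p, hp, hy⟩
  · exact Or.inl ⟨h, p.concat h, hp.concat hy h, by simp [Walk.support_concat]⟩

lemma Par.not_anc (hT : T.IsTree) {x y : V} (h : Par T r x y) : ¬ Anc T r y x :=
  fun h' => h.1.ne (h.2.antisymm hT h')

lemma Par.anc_iff (hT : T.IsTree) {x y z : V} (h : Par T r x y) :
    Anc T r z y ↔ z = y ∨ Anc T r z x := by
  obtain ⟨p, hp⟩ := exists_isPath hT r x
  have hy : y ∉ p.support := fun hy => h.not_anc hT ⟨p, hp, hy⟩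
  unfold Anc
  rw [onPath_iff hT (hp.concat hy h.1), onPath_iff hT hp, Walk.support_concat]
  simp [or_comm]

lemma Par.unique (hT : T.IsTree) {x x' y : V} (h : Par T r x y) (h' : Par T r x' y) : x = x' := by
  have h1 : Anc T r x x' := ((h'.anc_iff hT).1 h.2).resolve_left h.1.ne
  have h2 : Anc T r x' x := ((h.anc_iff hT).1 h'.2).resolve_left h'.1.ne
  exact h1.antisymm hT h2

lemma Par.ne_root (hT : T.IsTree) {x y : V} (h : Par T r x y) : y ≠ r := by
  rintro rfl
  exact h.not_anc hT (anc_root hT x)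

/-- A proper ancestor of `w` has a child that is an ancestor of `w`. -/
lemma Anc.exists_child (hT : T.IsTree) {x w : V} (h : Anc T r x w) (hne : x ≠ w) :
    ∃ c, Par T r x c ∧ Anc T r c w := by
  classical
  obtain ⟨p, hp, hx⟩ := h
  obtain ⟨d, hd, h1, h2⟩ := (p.dropUntil x hx).exists_boundary_dart
    {z | Anc T r z x} (anc_refl hT x) (fun h => hne ((Anc.antisymm hT ⟨p, hp, hx⟩ h)))
  have hw : ∀ z ∈ (p.dropUntil x hx).support, Anc T r z w := fun z hz =>
    ⟨p, hp, p.support_dropUntil_subset_support hx hz⟩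
  have hd1 := hw _ ((p.dropUntil x hx).dart_fst_mem_support_of_mem_darts hd)
  have hd2 := hw _ ((p.dropUntil x hx).dart_snd_mem_support_of_mem_darts hd)
  have hx2 : Anc T r x d.snd := (Anc.total hT hd2 ⟨p, hp, hx⟩).resolve_left h2
  have hpar : Par T r d.fst d.snd := by
    rcases par_or_par (r := r) hT d.adj with h | h
    · exact h
    · exact absurd (h.2.trans hT h1) h2
  have : x = d.fst := by
    rcases (hpar.anc_iff hT).1 hx2 with h | h
    · exact absurd (h ▸ anc_refl hT x) h2
    · exact h.antisymm hT h1
  exact ⟨d.snd, this ▸ hpar, hd2⟩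

lemma exists_par (hT : T.IsTree) {y : V} (hy : y ≠ r) : ∃ x, Par T r x y := by
  obtain ⟨p, hp⟩ := exists_isPath hT r y
  obtain ⟨d, hd, h1, h2⟩ := p.reverse.exists_boundary_dart {y} rfl (fun h => hy h.symm)
  have h1 : d.fst = y := h1
  refine ⟨d.snd, h1 ▸ d.adj.symm, p, hp, ?_⟩
  simpa using p.reverse.dart_snd_mem_support_of_mem_darts hd

/-- An edge leaving the set of descendants of `y` joins `y` to its parent. -/
lemma Anc.boundary (hT : T.IsTree) {y p q : V} (h : T.Adj p q) (hp : Anc T r y p)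
    (hq : ¬ Anc T r y q) : p = y ∧ Par T r q y := by
  rcases par_or_par (r := r) hT h with h' | h'
  · exact absurd (hp.trans hT h'.2) hq
  · rcases (h'.anc_iff hT).1 hp with rfl | h3
    · exact ⟨rfl, h'⟩
    · exact absurd h3 hq

/-- A path that leaves the descendants of `y` runs through `y` and its parent. -/
lemma Par.onPath_of_anc (hT : T.IsTree) {x y u v : V} (h : Par T r x y) (hu : Anc T r y u)
    (hv : ¬ Anc T r y v) : OnPath T u v x ∧ OnPath T u v y := by
  obtain ⟨p, hp⟩ := exists_isPath hT u v
  obtain ⟨d, hd, h1, h2⟩ := p.exists_boundary_dart {z | Anc T r y z} hu hv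
  obtain ⟨h3, h4⟩ := Anc.boundary hT d.adj h1 h2
  refine ⟨⟨p, hp, ?_⟩, ⟨p, hp, ?_⟩⟩
  · rw [h.unique hT h4]; exact p.dart_snd_mem_support_of_mem_darts hd
  · rw [← h3]; exact p.dart_fst_mem_support_of_mem_darts hd

lemma onPath_split [DecidableEq V] {u v w z : V} {p : T.Walk u v} (hp : p.IsPath)
    (hw : w ∈ p.support) (h1 : z ∈ (p.takeUntil w hw).support)
    (h2 : z ∈ (p.dropUntil w hw).support) : z = w := by
  by_contra hne
  have h3 := hp
  rw [← p.take_spec hw] at h3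
  exact h3.ne_of_mem_support_of_append hne h1 h2 rfl

/-- A path between two descendants of `y` stays among the descendants of `y`. -/
lemma OnPath.anc (hT : T.IsTree) {y u v w : V} (h : OnPath T u v w) (hu : Anc T r y u)
    (hv : Anc T r y v) : Anc T r y w := by
  classical
  by_cases hy : y = r
  · rw [hy]; exact anc_root hT w
  obtain ⟨x, hx⟩ := exists_par hT hy
  by_contra hw
  obtain ⟨p, hp, hwp⟩ := h
  have h1 := (onPath_iff hT (hp.takeUntil hwp)).1 (hx.onPath_of_anc hT hu hw).2
  have h2 := (onPath_iff hT (hp.dropUntil hwp)).1 (hx.onPath_of_anc hT hv hw).2.symm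
  have := onPath_split hp hwp h1 h2
  exact hw (this ▸ anc_refl hT y)

/-- A path between two non-descendants of `y` avoids the descendants of `y`. -/
lemma OnPath.not_anc (hT : T.IsTree) {y u v w : V} (h : OnPath T u v w) (hu : ¬ Anc T r y u)
    (hv : ¬ Anc T r y v) : ¬ Anc T r y w := by
  classical
  intro hw
  have hy : y ≠ r := by rintro rfl; exact hu (anc_root hT u)
  obtain ⟨x, hx⟩ := exists_par hT hy
  obtain ⟨p, hp, hwp⟩ := h
  have h1 := (onPath_iff hT (hp.takeUntil hwp)).1 (hx.onPath_of_anc hT hw hu).1.symm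
  have h2 := (onPath_iff hT (hp.dropUntil hwp)).1 (hx.onPath_of_anc hT hw hv).1
  have := onPath_split hp hwp h1 h2
  exact hx.not_anc hT (this ▸ hw)

lemma list_cons_le_cons_iff {α : Type*} [LinearOrder α] {a b : α} {l m : List α} :
    a :: l ≤ b :: m ↔ a < b ∨ a = b ∧ l ≤ m := by
  rw [le_iff_lt_or_eq, le_iff_lt_or_eq, List.cons.injEq]
  have : a :: l < b :: m ↔ a < b ∨ a = b ∧ l < m := List.cons_lex_cons_iff
  tauto

lemma list_nil_le {α : Type*} [LinearOrder α] (l : List α) : [] ≤ l := by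
  cases l with
  | nil => exact le_rfl
  | cons a l => exact le_of_lt (α := List α) List.Lex.nil

/-- A set of lists with a common prefix is convex in the lexicographic order. -/
lemma prefix_of_le_of_le {α : Type*} [LinearOrder α] (p : List α) :
    ∀ l m n : List α, p <+: l → p <+: n → l ≤ m → m ≤ n → p <+: m := by
  induction p with
  | nil => intro l m n _ _ _ _; exact List.nil_prefix
  | cons a p ih =>
    rintro _ m _ ⟨l, rfl⟩ ⟨n, rfl⟩ h1 h2
    cases m with
    | nil => exact absurd ((list_nil_le _).antisymm h1) (by simp)
    | cons b m =>
      rw [List.cons_append, list_cons_le_cons_iff] at h1 h2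
      have : a = b := by
        rcases h1 with h1 | ⟨h1, -⟩
        · rcases h2 with h2 | ⟨h2, -⟩
          · exact absurd h1 h2.asymm
          · exact h2.symm
        · exact h1
      subst this
      rw [List.cons_prefix_cons]
      refine ⟨rfl, ih (p ++ l) m (p ++ n) (List.prefix_append _ _) (List.prefix_append _ _) ?_ ?_⟩
      · rcases h1 with h1 | h1
        · exact absurd h1 (lt_irrefl _)
        · exact h1.2
      · rcases h2 with h2 | h2
        · exact absurd h2 (lt_irrefl _)
        · exact h2.2

lemma le_of_prefix {α : Type*} [LinearOrder α] : ∀ {l m : List α}, l <+: m → l ≤ m := by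
  intro l
  induction l with
  | nil => intro m _; exact list_nil_le m
  | cons a l ih =>
    rintro _ ⟨m, rfl⟩
    rw [List.cons_append, list_cons_le_cons_iff]
    exact Or.inr ⟨rfl, ih (List.prefix_append _ _)⟩

/-- The depth-first preorder of a rooted tree: ancestors come first, and the descendants of any
vertex are consecutive. It is the lexicographic order of the paths from the root. -/
lemma exists_preorder [Fintype V] (hT : T.IsTree) (r : V) : ∃ ord : V → ℕ, ord.Injective ∧
    (∀ x y, Anc T r x y → ord x ≤ ord y) ∧
    ∀ y a b c, Anc T r y a → Anc T r y c → ord a ≤ ord b → ord b ≤ ord c → Anc T r y b := by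
  classical
  choose p hp using fun w => exists_isPath hT r w
  let key : V → List (Fin (Fintype.card V)) := fun w => (p w).support.map (Fintype.equivFin V)
  have hkey : ∀ y w, Anc T r y w ↔ key y <+: key w := by
    intro y w
    constructor
    · intro h
      have h1 := (onPath_iff hT (hp w)).1 h
      have h2 : (p w).takeUntil y h1 = p y :=
        (hT.existsUnique_path r y).unique ((hp w).takeUntil h1) (hp y)
      have h3 := (p w).support_takeUntil_prefix_support h1
      rw [h2] at h3
      exact h3.map _
    · intro h
      have h1 : Fintype.equivFin V y ∈ key w :=
        h.subset (List.mem_map_of_mem (p y).end_mem_support)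
      obtain ⟨z, hz, hzy⟩ := List.mem_map.1 h1
      exact ⟨p w, hp w, by rwa [← (Fintype.equivFin V).injective hzy]⟩
  let ord : V → ℕ := fun w => (Finset.univ.filter fun v => key v < key w).card
  have hlt : ∀ x y, key x < key y → ord x < ord y := by
    intro x y h
    refine Finset.card_lt_card ⟨fun v hv => ?_, fun hsub => ?_⟩
    · simp only [Finset.mem_filter, Finset.mem_univ, true_and] at hv ⊢
      exact hv.trans h
    · have := hsub (show x ∈ _ by simpa using h)
      simp at this
  have hle : ∀ x y, ord x ≤ ord y → key x ≤ key y := fun x y h =>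
    not_lt.1 fun h' => absurd (hlt _ _ h') (not_lt.2 h)
  have hinj : ∀ x y, key x = key y → x = y := fun x y h =>
    Anc.antisymm hT ((hkey x y).2 (h ▸ List.prefix_rfl)) ((hkey y x).2 (h ▸ List.prefix_rfl))
  refine ⟨ord, fun x y h => hinj x y ((hle x y h.le).antisymm (hle y x h.ge)), ?_, ?_⟩
  · intro x y h
    rcases (le_of_prefix ((hkey x y).1 h)).lt_or_eq with h | h
    · exact (hlt x y h).le
    · exact (congrArg ord (hinj x y h)).le
  · intro y a b c ha hc hab hbc
    exact (hkey y b).2 (prefix_of_le_of_le _ _ _ _ ((hkey y a).1 ha) ((hkey y c).1 hc)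
      (hle a b hab) (hle b c hbc))

end Rooted

/-! ### Bare paths and `h2star` -/

section BarePaths

variable {V : Type*} {T : SimpleGraph V}

lemma IsPath.edge_eq_first {u v : V} {p : T.Walk u v} (hp : p.IsPath) {e : Sym2 V}
    (he : e ∈ p.edges) (hu : u ∈ e) : e = s(u, p.snd) := by
  obtain ⟨z, rfl⟩ := Sym2.mem_iff_exists.1 hu
  have hnil : ¬ p.Nil := by
    intro h
    rw [Walk.edges_eq_nil.2 h] at he
    simp at he
  have h1 : z ∈ p.toSubgraph.neighborSet u := Walk.adj_toSubgraph_iff_mem_edges.2 he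
  rw [Walk.IsPath.neighborSet_toSubgraph_startpoint hp hnil] at h1
  rw [Set.mem_singleton_iff.1 h1]

lemma IsPath.edge_eq_last {u v : V} {p : T.Walk u v} (hp : p.IsPath) {e : Sym2 V}
    (he : e ∈ p.edges) (hv : v ∈ e) : e = s(v, p.penultimate) := by
  have := IsPath.edge_eq_first hp.reverse (e := e) (by simpa using he) hv
  simpa using this

lemma ncard_neighborSet_inner {u v : V} {p : T.Walk u v} (hp : p.IsPath) {w : V}
    (hwp : w ∈ p.support) (hu : w ≠ u) (hv : w ≠ v) : (p.toSubgraph.neighborSet w).ncard = 2 := by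
  obtain ⟨i, hi, hil⟩ := Walk.mem_support_iff_exists_getVert.1 hwp
  have h0 : i ≠ 0 := by
    rintro rfl
    exact hu (by rw [← hi, Walk.getVert_zero])
  have h1 : i < p.length := by
    refine lt_of_le_of_ne hil ?_
    rintro rfl
    exact hv (by rw [← hi, Walk.getVert_length])
  rw [← hi]
  exact hp.ncard_neighborSet_toSubgraph_internal_eq_two h0 h1

variable [Fintype V] [DecidableRel T.Adj]

lemma ncard_neighborSet_eq_degree (w : V) : (T.neighborSet w).ncard = T.degree w := by
  rw [Set.ncard_eq_toFinset_card', ← neighborFinset_def, card_neighborFinset_eq_degree]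

lemma two_le_degree_inner {u v : V} {p : T.Walk u v} (hp : p.IsPath) {w : V}
    (hwp : w ∈ p.support) (hu : w ≠ u) (hv : w ≠ v) : 2 ≤ T.degree w := by
  rw [← ncard_neighborSet_inner hp hwp hu hv, ← ncard_neighborSet_eq_degree]
  exact Set.ncard_le_ncard (p.toSubgraph.neighborSet_subset w) (Set.toFinite _)

/-- A path uses both edges at an inner vertex of degree two. -/
lemma mem_edges_of_degree_two {u v : V} {p : T.Walk u v} (hp : p.IsPath) {w z : V}
    (hu : w ≠ u) (hv : w ≠ v) (hw : T.degree w ≤ 2) (hwp : w ∈ p.support)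
    (hz : T.Adj w z) : s(w, z) ∈ p.edges := by
  have h3 : p.toSubgraph.neighborSet w = T.neighborSet w := by
    refine Set.eq_of_subset_of_ncard_le (p.toSubgraph.neighborSet_subset w) ?_ (Set.toFinite _)
    rwa [ncard_neighborSet_inner hp hwp hu hv, ncard_neighborSet_eq_degree]
  have h4 : z ∈ p.toSubgraph.neighborSet w := by rw [h3]; exact hz
  exact Walk.adj_toSubgraph_iff_mem_edges.1 h4

/-- If a set of edges that is closed at vertices of degree two contains one edge of a path with
inner degrees two, then it contains the whole path. -/
lemma edges_subset_of_closed (K : Set (Sym2 V))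
    (hK : ∀ w x z, T.degree w = 2 → s(w, x) ∈ K → T.Adj w z → s(w, z) ∈ K) {u v : V}
    (p : T.Walk u v) : p.IsPath → (∀ w ∈ p.support, w ≠ u → w ≠ v → T.degree w = 2) →
      (∃ e ∈ p.edges, e ∈ K) → ∀ e ∈ p.edges, e ∈ K := by
  induction p with
  | nil => simp
  | @cons u a v h p' ih =>
    intro hp hd hex
    rw [Walk.cons_isPath_iff] at hp
    have ih' := ih hp.1 (fun w hw hwa hwv => hd w (by simp [hw])
      (by rintro rfl; exact hp.2 hw) hwv)
    cases p' with
    | nil => simpa using hex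
    | @cons _ b _ h' p'' =>
      have hav : a ≠ v := by
        rintro rfl
        have := hp.1
        rw [Walk.cons_isPath_iff] at this
        exact this.2 p''.end_mem_support
      have ha : T.degree a = 2 := hd a (by simp) h.ne' hav
      rw [Walk.edges_cons] at hex ⊢
      obtain ⟨e, he, heK⟩ := hex
      rcases List.mem_cons.1 he with rfl | he
      · have h2 := hK a u b ha (by rwa [Sym2.eq_swap]) h'
        intro f hf
        rcases List.mem_cons.1 hf with rfl | hf
        · exact heK
        · exact ih' ⟨_, by simp, h2⟩ f hf
      · have h1 := ih' ⟨e, he, heK⟩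
        intro f hf
        rcases List.mem_cons.1 hf with rfl | hf
        · rw [Sym2.eq_swap]
          exact hK a b u ha (h1 _ (by simp)) h.symm
        · exact h1 f hf

/-- Distinct bare paths have no edge in common. -/
lemma barePaths_eq_of_common_edge {H H' : T.Subgraph} (h : H ∈ barePaths T)
    (h' : H' ∈ barePaths T) {e : Sym2 V} (he : e ∈ H.edgeSet) (he' : e ∈ H'.edgeSet) : H = H' := by
  obtain ⟨u, v, p, hp, huv, hu, hv, hd, rfl⟩ := h
  obtain ⟨u', v', p', hp', huv', hu', hv', hd', rfl⟩ := h'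
  rw [Walk.mem_edges_toSubgraph] at he he'
  have closed : ∀ {u v : V} {p : T.Walk u v}, p.IsPath → T.degree u ≠ 2 → T.degree v ≠ 2 →
      ∀ w x z, T.degree w = 2 → s(w, x) ∈ {e | e ∈ p.edges} → T.Adj w z →
        s(w, z) ∈ {e | e ∈ p.edges} := fun hp hu hv w x z hw hx hz =>
    mem_edges_of_degree_two hp (by rintro rfl; exact hu hw) (by rintro rfl; exact hv hw) hw.le
      (Walk.fst_mem_support_of_mem_edges _ hx) hz
  have key : ∀ f, f ∈ p.edges ↔ f ∈ p'.edges := fun f =>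
    ⟨edges_subset_of_closed _ (closed hp' hu' hv') p hp hd ⟨e, he, he'⟩ f,
     edges_subset_of_closed _ (closed hp hu hv) p' hp' hd' ⟨e, he', he⟩ f⟩
  refine Subgraph.ext ?_ ?_
  · ext w
    rw [Walk.mem_verts_toSubgraph, Walk.mem_verts_toSubgraph,
      Walk.mem_support_iff_exists_mem_edges_of_not_nil (Walk.not_nil_of_ne huv),
      Walk.mem_support_iff_exists_mem_edges_of_not_nil (Walk.not_nil_of_ne huv')]
    simp only [key]
  · ext a b
    rw [Walk.adj_toSubgraph_iff_mem_edges, Walk.adj_toSubgraph_iff_mem_edges, key]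

lemma exists_longer_of_degree_two (hT : T.IsTree) {u v : V} {p : T.Walk u v} (hp : p.IsPath)
    (hv : T.degree v = 2) : ∃ (z : V) (h : T.Adj v z), (p.concat h).IsPath := by
  classical
  have h1 : 1 < (T.neighborFinset v).card := by rw [card_neighborFinset_eq_degree, hv]; norm_num
  obtain ⟨z, hz, hne⟩ := Finset.exists_mem_ne h1 p.penultimate
  rw [mem_neighborFinset] at hz
  refine ⟨z, hz, hp.concat (fun hzp => hne ?_) hz⟩
  exact hT.isAcyclic.eq_penultimate_of_adj_end hp hz hzp

/-- Every edge of a tree lies on a bare path. -/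
lemma exists_barePath (hT : T.IsTree) {e : Sym2 V} (he : e ∈ T.edgeSet) :
    ∃ H ∈ barePaths T, e ∈ H.edgeSet := by
  classical
  by_contra hcon
  -- without a bare path through `e`, any path through `e` with inner degrees two can be prolonged
  have key : ∀ n : ℕ, ∃ (u v : V) (p : T.Walk u v), p.IsPath ∧ e ∈ p.edges ∧
      (∀ w ∈ p.support, w ≠ u → w ≠ v → T.degree w = 2) ∧ n ≤ p.length := by
    intro n
    induction n with
    | zero =>
      induction e with
      | _ a b =>
        have hab : T.Adj a b := he
        refine ⟨a, b, hab.toWalk, by simp [hab.ne], by simp, ?_, by simp⟩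
        intro w hw h1 h2
        simp at hw
        tauto
    | succ n ih =>
      obtain ⟨u, v, p, hp, hep, hd, hn⟩ := ih
      have ext : ∀ {u v : V} {p : T.Walk u v}, p.IsPath → e ∈ p.edges →
          (∀ w ∈ p.support, w ≠ u → w ≠ v → T.degree w = 2) → n ≤ p.length →
          T.degree v = 2 → ∃ (u v : V) (p : T.Walk u v), p.IsPath ∧ e ∈ p.edges ∧
          (∀ w ∈ p.support, w ≠ u → w ≠ v → T.degree w = 2) ∧ n + 1 ≤ p.length := by
        intro u v p hp hep hd hn hv
        obtain ⟨z, hz, hpz⟩ := exists_longer_of_degree_two hT hp hv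
        refine ⟨u, z, p.concat hz, hpz, by simp [Walk.edges_concat, hep], ?_, by simpa⟩
        intro w hw hwu hwz
        rw [Walk.support_concat] at hw
        rcases List.mem_append.1 hw with hw | hw
        · by_cases hwv : w = v
          · rw [hwv, hv]
          · exact hd w hw hwu hwv
        · simp at hw
          exact absurd hw hwz
      by_cases hv : T.degree v = 2
      · exact ext hp hep hd hn hv
      by_cases hu : T.degree u = 2
      · exact ext hp.reverse (by simpa using hep)
          (fun w hw h1 h2 => hd w (by simpa using hw) h2 h1) (by simpa using hn) hu
      refine absurd ⟨p.toSubgraph, ⟨u, v, p, hp, ?_, hu, hv, hd, rfl⟩, ?_⟩ hcon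
      · rintro rfl
        rw [Walk.edges_eq_nil.2 (Walk.isPath_iff_nil.1 hp)] at hep
        simp at hep
      · rw [Walk.mem_edges_toSubgraph]; exact hep
  obtain ⟨u, v, p, hp, -, -, hn⟩ := key (Fintype.card V)
  exact absurd hp.length_lt (not_lt.2 hn)

open Classical in
/-- The edges both of whose endpoints have degree at most two. -/
noncomputable def lowEdges (T : SimpleGraph V) [DecidableRel T.Adj] : Finset (Sym2 V) :=
  T.edgeFinset.filter fun e => ∀ v ∈ e, T.degree v ≤ 2

open Classical in
/-- The edges both of whose endpoints have degree exactly two. -/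
noncomputable def midEdges (T : SimpleGraph V) [DecidableRel T.Adj] : Finset (Sym2 V) :=
  T.edgeFinset.filter fun e => ∀ v ∈ e, T.degree v = 2

open Classical in
/-- The contribution of a bare path to `h2star`. -/
noncomputable def bareWeight (T : SimpleGraph V) [DecidableRel T.Adj] (H : T.Subgraph) : ℕ :=
  if H ∈ leaflessLong T then H.edgeSet.ncard - 2 else H.edgeSet.ncard - 1

lemma h2star_eq_sum : h2star T = ∑ H ∈ (Set.toFinite (barePaths T)).toFinset, bareWeight T H := by
  classical
  have hsub : leaflessLong T ⊆ barePaths T := fun H h => h.1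
  have h1 : ∑ᶠ H ∈ barePaths T \ leaflessLong T, (H.edgeSet.ncard - 1) =
      ∑ᶠ H ∈ barePaths T \ leaflessLong T, bareWeight T H :=
    finsum_mem_congr rfl fun H hH => by rw [bareWeight, if_neg hH.2]
  have h2 : ∑ᶠ H ∈ leaflessLong T, (H.edgeSet.ncard - 2) =
      ∑ᶠ H ∈ leaflessLong T, bareWeight T H :=
    finsum_mem_congr rfl fun H hH => by rw [bareWeight, if_pos hH]
  rw [h2star, h1, h2, ← finsum_mem_union Set.disjoint_sdiff_left (Set.toFinite _) (Set.toFinite _),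
    Set.sdiff_union_of_subset hsub, finsum_mem_eq_finite_toFinset_sum]

/-- Only the first and the last edge of a bare path can have an endpoint of degree at least three,
and if an extreme is a leaf, then its edge has none there. -/
lemma bareWeight_le_card_lowEdges {H : T.Subgraph} (hH : H ∈ barePaths T) :
    bareWeight T H ≤ {e ∈ (lowEdges T : Set (Sym2 V)) | e ∈ H.edgeSet}.ncard := by
  classical
  have hH' := hH
  obtain ⟨u, v, p, hp, huv, hu, hv, hd, rfl⟩ := hH
  set L : Set (Sym2 V) := {e ∈ (lowEdges T : Set (Sym2 V)) | e ∈ p.toSubgraph.edgeSet} with hL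
  have hmem : ∀ e ∈ p.toSubgraph.edgeSet, (∀ w ∈ e, T.degree w ≤ 2) → e ∈ L := by
    intro e he h
    refine ⟨?_, he⟩
    simp only [lowEdges, Finset.coe_filter, mem_edgeFinset]
    exact ⟨p.toSubgraph.edgeSet_subset he, h⟩
  have hinner : ∀ e ∈ p.edges, ∀ w ∈ e, w ≠ u → w ≠ v → T.degree w = 2 := by
    intro e he w hw h1 h2
    exact hd w (p.mem_support_of_mem_edges he hw) h1 h2
  have h2 : p.toSubgraph.edgeSet.ncard - 2 ≤ L.ncard := by
    have : p.toSubgraph.edgeSet ⊆ L ∪ {s(u, p.snd), s(v, p.penultimate)} := by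
      intro e he
      have he' := (Walk.mem_edges_toSubgraph p).1 he
      by_cases h1 : u ∈ e
      · right; left; exact IsPath.edge_eq_first hp he' h1
      by_cases h2 : v ∈ e
      · right; right; exact IsPath.edge_eq_last hp he' h2
      left
      refine hmem e he fun w hw => (hinner e he' w hw ?_ ?_).le
      · rintro rfl; exact h1 hw
      · rintro rfl; exact h2 hw
    have h3 := Set.ncard_le_ncard this (Set.toFinite _)
    have h4 := Set.ncard_union_le L {s(u, p.snd), s(v, p.penultimate)}
    have h5 := Set.ncard_insert_le s(u, p.snd) {s(v, p.penultimate)}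
    rw [Set.ncard_singleton] at h5
    omega
  rw [bareWeight]
  split_ifs with hI
  · exact h2
  by_cases hlen : 2 ≤ p.toSubgraph.edgeSet.ncard
  swap
  · omega
  have hleaf : T.degree u = 1 ∨ T.degree v = 1 := by
    by_contra hcon
    push Not at hcon
    refine hI ⟨hH', fun w hw => ?_, hlen⟩
    rw [Walk.mem_verts_toSubgraph] at hw
    by_cases h1 : w = u
    · rw [h1]; exact hcon.1
    by_cases h3 : w = v
    · rw [h3]; exact hcon.2
    rw [hd w hw h1 h3]; norm_num
  have h1 : ∃ f, p.toSubgraph.edgeSet ⊆ L ∪ {f} := by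
    rcases hleaf with h | h
    · refine ⟨s(v, p.penultimate), fun e he => ?_⟩
      have he' := (Walk.mem_edges_toSubgraph p).1 he
      by_cases h2 : v ∈ e
      · right; exact IsPath.edge_eq_last hp he' h2
      left
      refine hmem e he fun w hw => ?_
      by_cases h1 : w = u
      · rw [h1, h]; norm_num
      · refine (hinner e he' w hw h1 ?_).le
        rintro rfl; exact h2 hw
    · refine ⟨s(u, p.snd), fun e he => ?_⟩
      have he' := (Walk.mem_edges_toSubgraph p).1 he
      by_cases h2 : u ∈ e
      · right; exact IsPath.edge_eq_first hp he' h2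
      left
      refine hmem e he fun w hw => ?_
      by_cases h1 : w = v
      · rw [h1, h]; norm_num
      · refine (hinner e he' w hw ?_ h1).le
        rintro rfl; exact h2 hw
  obtain ⟨f, hf⟩ := h1
  have h3 := Set.ncard_le_ncard hf (Set.toFinite _)
  have h4 := Set.ncard_union_le L {f}
  rw [Set.ncard_singleton] at h4
  omega

/-- The first and the last edge of a bare path do not join vertices of degree two. -/
lemma card_midEdges_le_bareWeight {H : T.Subgraph} (hH : H ∈ barePaths T) :
    {e ∈ (midEdges T : Set (Sym2 V)) | e ∈ H.edgeSet}.ncard ≤ bareWeight T H := by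
  classical
  obtain ⟨u, v, p, hp, huv, hu, hv, hd, rfl⟩ := hH
  have hnil : ¬ p.Nil := Walk.not_nil_of_ne huv
  have hw : p.toSubgraph.edgeSet.ncard - 2 ≤ bareWeight T p.toSubgraph := by
    rw [bareWeight]; split_ifs <;> omega
  have hsub : {e ∈ (midEdges T : Set (Sym2 V)) | e ∈ p.toSubgraph.edgeSet} ⊆
      (p.toSubgraph.edgeSet \ {s(u, p.snd)}) \ {s(v, p.penultimate)} := by
    rintro e ⟨he, heH⟩
    simp only [midEdges, Finset.coe_filter] at he
    refine ⟨⟨heH, ?_⟩, ?_⟩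
    · rintro rfl; exact hu (he.2 u (Sym2.mem_mk_left _ _))
    · rintro rfl; exact hv (he.2 v (Sym2.mem_mk_left _ _))
  have hfirst : s(u, p.snd) ∈ p.toSubgraph.edgeSet := p.toSubgraph_adj_snd hnil
  have hlast : s(v, p.penultimate) ∈ p.toSubgraph.edgeSet :=
    (p.toSubgraph_adj_penultimate hnil).symm
  have h1 := Set.ncard_sdiff_singleton_of_mem hfirst
  have h2 := Set.ncard_le_ncard hsub (Set.toFinite _)
  by_cases heq : s(u, p.snd) = s(v, p.penultimate)
  · -- the path has a single edge, whose endpoints do not have degree two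
    have hall : ∀ e ∈ p.toSubgraph.edgeSet, e = s(u, p.snd) := by
      intro e he
      have hsnd : p.snd = v := by
        rcases Sym2.eq_iff.1 heq with ⟨h, -⟩ | ⟨-, h⟩
        · exact absurd h huv
        · exact h
      have hlen : p.length = 1 := by
        have h3 : p.getVert 1 = p.getVert p.length := by rw [p.getVert_length]; exact hsnd
        have h4 : 1 ≤ p.length := by
          rcases Nat.eq_zero_or_pos p.length with h | h
          · exact absurd (Walk.length_eq_zero_iff.1 h) hnil
          · exact h
        exact (hp.getVert_injOn (by simpa using h4) (by simp) h3).symm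
      have he' := (Walk.mem_edges_toSubgraph p).1 he
      have h5 : s(u, p.snd) ∈ p.edges := (Walk.mem_edges_toSubgraph p).1 hfirst
      have h6 : p.edges.length = 1 := by rw [Walk.length_edges, hlen]
      obtain ⟨f, hf⟩ := List.length_eq_one_iff.1 h6
      rw [hf, List.mem_singleton] at he' h5
      rw [he', h5]
    have : {e ∈ (midEdges T : Set (Sym2 V)) | e ∈ p.toSubgraph.edgeSet} = ∅ := by
      refine Set.eq_empty_of_forall_notMem fun e he => ?_
      exact (hsub he).1.2 (hall e he.2)
    rw [this]; simp
  · have h3 : s(v, p.penultimate) ∈ p.toSubgraph.edgeSet \ {s(u, p.snd)} :=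
      ⟨hlast, fun h => heq (Set.mem_singleton_iff.1 h).symm⟩
    have h4 := Set.ncard_sdiff_singleton_of_mem h3
    omega

/-- Since bare paths are edge-disjoint, `h2star` is at most the number of edges joining vertices
of degree at most two. -/
lemma h2star_le_card_lowEdges : h2star T ≤ (lowEdges T).card := by
  classical
  rw [h2star_eq_sum]
  calc _ ≤ ∑ H ∈ (Set.toFinite (barePaths T)).toFinset,
        ((lowEdges T).filter fun e => e ∈ H.edgeSet).card := by
        refine Finset.sum_le_sum fun H hH => ?_
        have := bareWeight_le_card_lowEdges ((Set.Finite.mem_toFinset _).1 hH)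
        rwa [← Set.ncard_coe_finset, Finset.coe_filter]
    _ = (((Set.toFinite (barePaths T)).toFinset).biUnion fun H =>
        (lowEdges T).filter fun e => e ∈ H.edgeSet).card := by
        refine (Finset.card_biUnion fun H hH H' hH' hne => ?_).symm
        rw [Function.onFun, Finset.disjoint_left]
        intro e he he'
        exact hne (barePaths_eq_of_common_edge ((Set.Finite.mem_toFinset _).1 hH)
          ((Set.Finite.mem_toFinset _).1 hH') (Finset.mem_filter.1 he).2
          (Finset.mem_filter.1 he').2)
    _ ≤ (lowEdges T).card := Finset.card_le_card (Finset.biUnion_subset.2 fun H _ =>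
        Finset.filter_subset _ _)

/-- Since every edge lies on a bare path, `h2star` is at least the number of edges joining
vertices of degree two. -/
lemma card_midEdges_le_h2star (hT : T.IsTree) : (midEdges T).card ≤ h2star T := by
  classical
  rw [h2star_eq_sum]
  calc (midEdges T).card ≤ (((Set.toFinite (barePaths T)).toFinset).biUnion fun H =>
        (midEdges T).filter fun e => e ∈ H.edgeSet).card := by
        refine Finset.card_le_card fun e he => ?_
        obtain ⟨H, hH, heH⟩ := exists_barePath hT
          (mem_edgeFinset.1 (Finset.mem_filter.1 he).1)
        exact Finset.mem_biUnion.2 ⟨H, (Set.Finite.mem_toFinset _).2 hH,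
          Finset.mem_filter.2 ⟨he, heH⟩⟩
    _ ≤ ∑ H ∈ (Set.toFinite (barePaths T)).toFinset,
        ((midEdges T).filter fun e => e ∈ H.edgeSet).card := Finset.card_biUnion_le
    _ ≤ _ := by
        refine Finset.sum_le_sum fun H hH => ?_
        have := card_midEdges_le_bareWeight ((Set.Finite.mem_toFinset _).1 hH)
        rwa [← Set.ncard_coe_finset, Finset.coe_filter]

end BarePaths

/-! ### The lower bound -/

section LowerBound

variable {V : Type*} {T : SimpleGraph V} [Fintype V] [DecidableRel T.Adj]

open Classical in
/-- The leaves of the tree. -/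
noncomputable def leaves (T : SimpleGraph V) [DecidableRel T.Adj] : Finset V :=
  Finset.univ.filter fun v => T.degree v = 1

lemma mem_leaves {v : V} : v ∈ leaves T ↔ T.degree v = 1 := by simp [leaves]

lemma h1_eq_card_leaves : h1 T = (leaves T).card := by
  rw [h1, ← Set.ncard_coe_finset]
  congr 1
  ext v
  simp [leaves]

/-- The path `p` contains exactly one endpoint of the edge `e`. -/
def Cuts {u v : V} (p : T.Walk u v) (e : Sym2 V) : Prop :=
  ∃ x y, e = s(x, y) ∧ x ∈ p.support ∧ y ∉ p.support

open Classical in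
lemma card_cut_at_le {u v : V} (p : T.Walk u v) (x : V) :
    ((lowEdges T).filter fun e => ∃ y, e = s(x, y) ∧ y ∉ p.support).card ≤
      if T.degree x ≤ 2 then ((T.neighborFinset x).filter fun y => y ∉ p.support).card else 0 := by
  split_ifs with hx
  · refine (Finset.card_le_card fun e he => ?_).trans (Finset.card_image_le (f := fun y => s(x, y)))
    obtain ⟨he, y, rfl, hy⟩ := Finset.mem_filter.1 he
    have hxy : T.Adj x y := mem_edgeFinset.1 (Finset.mem_filter.1 he).1
    exact Finset.mem_image.2 ⟨y, Finset.mem_filter.2 ⟨by simpa using hxy, hy⟩, rfl⟩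
  · rw [Nat.le_zero, Finset.card_eq_zero, Finset.filter_eq_empty_iff]
    rintro e he ⟨y, rfl, -⟩
    exact hx ((Finset.mem_filter.1 he).2 x (Sym2.mem_mk_left _ _))

open Classical in
/-- The number of leaves in a path plus the number of edges between vertices of degree at most two
that it cuts is at most two: each extreme of the path accounts for at most one of them (and if the
extremes coincide, that vertex accounts for at most two). -/
lemma card_leaves_add_card_cut_le {u v : V} {p : T.Walk u v} (hp : p.IsPath) :
    ((leaves T).filter fun w => w ∈ p.support).card + ((lowEdges T).filter (Cuts p)).card ≤ 2 := by
  let C : V → Finset (Sym2 V) := fun x =>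
    (lowEdges T).filter fun e => ∃ y, e = s(x, y) ∧ y ∉ p.support
  have hleaf : ((leaves T).filter fun w => w ∈ p.support) ⊆
      ({u, v} : Finset V).filter fun w => T.degree w = 1 := by
    intro w hw
    obtain ⟨hw, hwp⟩ := Finset.mem_filter.1 hw
    rw [mem_leaves] at hw
    refine Finset.mem_filter.2 ⟨?_, hw⟩
    by_contra hcon
    simp only [Finset.mem_insert, Finset.mem_singleton, not_or] at hcon
    have := two_le_degree_inner hp hwp hcon.1 hcon.2
    omega
  have hcut : (lowEdges T).filter (Cuts p) ⊆ ({u, v} : Finset V).biUnion C := by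
    intro e he
    obtain ⟨he, x, y, rfl, hx, hy⟩ := Finset.mem_filter.1 he
    refine Finset.mem_biUnion.2 ⟨x, ?_, Finset.mem_filter.2 ⟨he, y, rfl, hy⟩⟩
    by_contra hcon
    simp only [Finset.mem_insert, Finset.mem_singleton, not_or] at hcon
    have hxy : T.Adj x y := mem_edgeFinset.1 (Finset.mem_filter.1 he).1
    have := mem_edges_of_degree_two hp hcon.1 hcon.2
      ((Finset.mem_filter.1 he).2 x (Sym2.mem_mk_left _ _)) hx hxy
    exact hy (p.snd_mem_support_of_mem_edges this)
  have hsum : ((leaves T).filter fun w => w ∈ p.support).card +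
      ((lowEdges T).filter (Cuts p)).card ≤
      ∑ x ∈ ({u, v} : Finset V), ((if T.degree x = 1 then 1 else 0) + (C x).card) := by
    rw [Finset.sum_add_distrib, ← Finset.card_filter]
    exact Nat.add_le_add (Finset.card_le_card hleaf)
      ((Finset.card_le_card hcut).trans Finset.card_biUnion_le)
  refine hsum.trans ?_
  by_cases huv : u = v
  · rw [huv, Finset.pair_eq_singleton, Finset.sum_singleton]
    have h1 : (C v).card ≤ _ := card_cut_at_le p v
    have h2 := Finset.card_filter_le (T.neighborFinset v) fun y => y ∉ p.support
    rw [card_neighborFinset_eq_degree] at h2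
    split_ifs at h1 ⊢ <;> omega
  · have key : ∀ x z, T.Adj x z → z ∈ p.support →
        (if T.degree x = 1 then 1 else 0) + (C x).card ≤ 1 := by
      intro x z hxz hz
      have h1 : (C x).card ≤ _ := card_cut_at_le p x
      have h2 : ((T.neighborFinset x).filter fun y => y ∉ p.support).card <
          (T.neighborFinset x).card := by
        refine Finset.card_lt_card (Finset.filter_ssubset.2 ⟨z, by simpa using hxz, ?_⟩)
        simpa using hz
      rw [card_neighborFinset_eq_degree] at h2
      split_ifs at h1 ⊢ <;> omega
    have hnil : ¬ p.Nil := Walk.not_nil_of_ne huv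
    rw [Finset.sum_pair huv]
    have h1 := key u p.snd (p.adj_snd hnil) (p.getVert_mem_support 1)
    have h2 := key v p.penultimate (p.adj_penultimate hnil).symm (p.getVert_mem_support _)
    omega

/-- The two counting bounds for a separating and covering family. The second one improves the
first since each path contains at most one leaf that lies on no other path. -/
lemma counting_bounds {F : Finset (AnyPath T)}
    (hS : Separates F (vertexElems T)) (hC : Covers F (vertexElems T)) :
    h1 T + h2star T ≤ 2 * F.card ∧ 2 * h1 T + h2star T ≤ 3 * F.card := by
  classical
  have hcov : ∀ w : V, ∃ P ∈ F, w ∈ P.2.2.1.support := fun w => hC (Sum.inl w) ⟨w, rfl⟩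
  have hsep : ∀ x y : V, x ≠ y → ∃ P ∈ F, (x ∈ P.2.2.1.support ∧ y ∉ P.2.2.1.support) ∨
      (x ∉ P.2.2.1.support ∧ y ∈ P.2.2.1.support) := fun x y hxy =>
    hS (Sum.inl x) ⟨x, rfl⟩ (Sum.inl y) ⟨y, rfl⟩ (by simpa using hxy)
  let deg : V → ℕ := fun w => (F.filter fun P => w ∈ P.2.2.1.support).card
  have htotal : ∑ w ∈ leaves T, deg w +
      ∑ e ∈ lowEdges T, (F.filter fun P => Cuts P.2.2.1 e).card ≤ 2 * F.card := by
    calc _ = ∑ P ∈ F, (((leaves T).filter fun w => w ∈ P.2.2.1.support).card +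
          ((lowEdges T).filter (Cuts P.2.2.1)).card) := by
          simp only [deg, Finset.card_filter, Finset.sum_add_distrib]
          rw [Finset.sum_comm, Finset.sum_comm (s := lowEdges T)]
      _ ≤ ∑ P ∈ F, 2 := Finset.sum_le_sum fun P _ => card_leaves_add_card_cut_le P.2.2.2
      _ = 2 * F.card := by rw [Finset.sum_const, smul_eq_mul, mul_comm]
  have hedges : h2star T ≤ ∑ e ∈ lowEdges T, (F.filter fun P => Cuts P.2.2.1 e).card := by
    refine h2star_le_card_lowEdges.trans ?_
    rw [Finset.card_eq_sum_ones]
    refine Finset.sum_le_sum fun e he => Finset.card_pos.2 ?_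
    induction e with
    | _ x y =>
      have hxy : T.Adj x y := mem_edgeFinset.1 (Finset.mem_filter.1 he).1
      obtain ⟨P, hP, h | h⟩ := hsep x y hxy.ne
      · exact ⟨P, Finset.mem_filter.2 ⟨hP, x, y, rfl, h⟩⟩
      · exact ⟨P, Finset.mem_filter.2 ⟨hP, y, x, Sym2.eq_swap, h.2, h.1⟩⟩
  have hdeg : ∀ w, 1 ≤ deg w := fun w => by
    obtain ⟨P, hP, hw⟩ := hcov w
    exact Finset.card_pos.2 ⟨P, Finset.mem_filter.2 ⟨hP, hw⟩⟩
  have hleaves : h1 T ≤ ∑ w ∈ leaves T, deg w := by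
    rw [h1_eq_card_leaves, Finset.card_eq_sum_ones]
    exact Finset.sum_le_sum fun w _ => hdeg w
  have honce : ((leaves T).filter fun w => deg w = 1).card ≤ F.card := by
    choose f hfF hf using hcov
    refine Finset.card_le_card_of_injOn f (fun w _ => hfF w) ?_
    intro x hx y hy hxy
    simp only [Finset.coe_filter, Set.mem_ofPred_eq] at hx hy
    have uniq : ∀ w, deg w = 1 → ∀ P ∈ F, w ∈ P.2.2.1.support → P = f w := by
      intro w hw P hP hwP
      obtain ⟨Q, hQ⟩ := Finset.card_eq_one.1 hw
      have h1 : P ∈ F.filter fun P => w ∈ P.2.2.1.support := Finset.mem_filter.2 ⟨hP, hwP⟩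
      have h2 : f w ∈ F.filter fun P => w ∈ P.2.2.1.support :=
        Finset.mem_filter.2 ⟨hfF w, hf w⟩
      rw [hQ, Finset.mem_singleton] at h1 h2
      rw [h1, h2]
    by_contra hne
    obtain ⟨P, hP, h | h⟩ := hsep x y hne
    · rw [uniq x hx.2 P hP h.1, hxy] at h
      exact h.2 (hf y)
    · rw [uniq y hy.2 P hP h.2, ← hxy] at h
      exact h.1 (hf x)
  have hleaves2 : 2 * h1 T ≤ ∑ w ∈ leaves T, deg w +
      ((leaves T).filter fun w => deg w = 1).card := by
    rw [h1_eq_card_leaves, Finset.card_filter, ← Finset.sum_add_distrib, mul_comm, ← smul_eq_mul,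
      ← Finset.sum_const]
    refine Finset.sum_le_sum fun w _ => ?_
    have := hdeg w
    split_ifs <;> omega
  omega

end LowerBound

/-! ### Cyclic enumerations and pairs of leaves -/

section Enumeration

variable {V : Type*}

/-- A cyclic enumeration `τ` of a nonempty finite set, increasing in `ord` on one period. -/
lemma exists_cyclic_enumeration {S : Finset V} (hS : S.Nonempty) {ord : V → ℕ}
    (hord : ord.Injective) : ∃ (τ : ℕ → V) (nx : V → V), (∀ n, τ n ∈ S) ∧
      (∀ n, τ (n + S.card) = τ n) ∧ (∀ s ∈ S, ∃ n < S.card, τ n = s) ∧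
      (∀ i j, i < j → j < S.card → ord (τ i) < ord (τ j)) ∧ ∀ n, τ (n + 1) = nx (τ n) := by
  classical
  have hcard : (S.image ord).card = S.card := Finset.card_image_of_injective _ hord
  have hpos : 0 < S.card := hS.card_pos
  let e := (S.image ord).orderEmbOfFin hcard
  have he : ∀ i, ∃ s ∈ S, ord s = e i := fun i =>
    Finset.mem_image.1 ((S.image ord).orderEmbOfFin_mem hcard i)
  choose g hgS hg using he
  let τ : ℕ → V := fun n => g ⟨n % S.card, Nat.mod_lt _ hpos⟩
  have hsurj : ∀ s ∈ S, ∃ n < S.card, τ n = s := by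
    intro s hs
    have h1 : ord s ∈ Set.range e := by
      rw [Finset.range_orderEmbOfFin]
      exact Finset.mem_coe.2 (Finset.mem_image_of_mem _ hs)
    obtain ⟨i, hi⟩ := h1
    refine ⟨i, i.2, hord ?_⟩
    simp only [τ, Nat.mod_eq_of_lt i.2]
    rw [hg, hi]
  have hmono : ∀ i j, i < j → j < S.card → ord (τ i) < ord (τ j) := by
    intro i j hij hj
    simp only [τ, Nat.mod_eq_of_lt hj, Nat.mod_eq_of_lt (hij.trans hj), hg]
    exact e.strictMono hij
  have hmod : ∀ n, τ (n % S.card) = τ n := fun n => by simp only [τ, Nat.mod_mod]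
  have hinj : ∀ i j, i < S.card → j < S.card → τ i = τ j → i = j := by
    intro i j hi hj h
    rcases lt_trichotomy i j with h1 | h1 | h1
    · exact absurd (congrArg ord h) (hmono i j h1 hj).ne
    · exact h1
    · exact absurd (congrArg ord h) (hmono j i h1 hi).ne'
  have hnx : ∀ s, ∃ t, ∀ n, τ n = s → τ (n + 1) = t := by
    intro s
    by_cases h : ∃ n, τ n = s
    · obtain ⟨n, rfl⟩ := h
      refine ⟨τ (n + 1), fun m hm => ?_⟩
      have h1 : m % S.card = n % S.card := hinj _ _ (Nat.mod_lt _ hpos) (Nat.mod_lt _ hpos)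
        (by rw [hmod, hmod, hm])
      rw [← hmod (m + 1), ← hmod (n + 1), Nat.add_mod, h1, ← Nat.add_mod]
    · exact ⟨s, fun n hn => absurd ⟨n, hn⟩ h⟩
  choose nx hnx using hnx
  exact ⟨τ, nx, fun n => hgS _, fun n => by rw [← hmod (n + S.card), Nat.add_mod_right, hmod],
    hsurj, hmono, fun n => hnx _ n rfl⟩

lemma exists_step {P : ℕ → Prop} {p q : ℕ} (hpq : p ≤ q) (hp : P p) (hq : ¬ P q) :
    ∃ n, p ≤ n ∧ n < q ∧ P n ∧ ¬ P (n + 1) := by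
  induction q, hpq using Nat.le_induction with
  | base => exact absurd hp hq
  | succ q hpq ih =>
    by_cases h : P q
    · exact ⟨q, hpq, Nat.lt_succ_self q, h, hq⟩
    · obtain ⟨n, h1, h2, h3⟩ := ih h
      exact ⟨n, h1, h2.trans (Nat.lt_succ_self q), h3⟩

/-- Any finite set is separated and covered by about two thirds as many pairs. -/
lemma exists_pairs_separating (R : Finset V) : ∃ Q : Finset (V × V),
    3 * Q.card ≤ 2 * R.card + 2 ∧ (∀ q ∈ Q, q.1 ∈ R ∧ q.2 ∈ R) ∧
    (∀ x ∈ R, ∃ q ∈ Q, x = q.1 ∨ x = q.2) ∧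
    ∀ x ∈ R, ∀ y ∈ R, x ≠ y → ∃ q ∈ Q, ((x = q.1 ∨ x = q.2) ∧ ¬ (y = q.1 ∨ y = q.2)) ∨
      (¬ (x = q.1 ∨ x = q.2) ∧ (y = q.1 ∨ y = q.2)) := by
  classical
  induction R using Finset.strongInduction with
  | H R ih =>
  by_cases h : R.card ≤ 2
  · refine ⟨R.image fun x => (x, x), ?_, ?_, ?_, ?_⟩
    · have := Finset.card_image_le (s := R) (f := fun x => (x, x))
      omega
    · simp
    · intro x hx
      exact ⟨(x, x), Finset.mem_image_of_mem _ hx, Or.inl rfl⟩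
    · intro x hx y hy hxy
      exact ⟨(x, x), Finset.mem_image_of_mem _ hx, Or.inl ⟨Or.inl rfl, by simpa using hxy.symm⟩⟩
  -- three elements `x`, `y`, `z` are treated by the pairs `(x, y)` and `(y, z)`
  obtain ⟨x, hx, y, hy, z, hz, hxy, hxz, hyz⟩ := Finset.two_lt_card.1 (not_le.1 h)
  have hsub : ({x, y, z} : Finset V) ⊆ R := by
    intro w; simp only [Finset.mem_insert, Finset.mem_singleton]
    rintro (rfl | rfl | rfl) <;> assumption
  have hcard3 : ({x, y, z} : Finset V).card = 3 :=
    Finset.card_eq_three.2 ⟨x, y, z, hxy, hxz, hyz, rfl⟩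
  have hcard := Finset.card_sdiff_add_card_eq_card hsub
  obtain ⟨Q, hQ, hQR, hcov, hsep⟩ := ih (R \ {x, y, z})
    (Finset.sdiff_ssubset hsub ⟨x, by simp⟩)
  have hmem : ∀ w, w ∈ R → w ∈ R \ {x, y, z} ∨ w = x ∨ w = y ∨ w = z := by
    intro w hw
    simp only [Finset.mem_sdiff, Finset.mem_insert, Finset.mem_singleton]
    tauto
  have hQ' : ∀ q ∈ Q, ∀ w, w = x ∨ w = y ∨ w = z → ¬ (w = q.1 ∨ w = q.2) := by
    rintro q hq w hw (rfl | rfl)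
    · have := (hQR q hq).1
      simp only [Finset.mem_sdiff, Finset.mem_insert, Finset.mem_singleton] at this
      exact this.2 hw
    · have := (hQR q hq).2
      simp only [Finset.mem_sdiff, Finset.mem_insert, Finset.mem_singleton] at this
      exact this.2 hw
  refine ⟨insert (x, y) (insert (y, z) Q), ?_, ?_, ?_, ?_⟩
  · have h1 := Finset.card_insert_le (x, y) (insert (y, z) Q)
    have h2 := Finset.card_insert_le (y, z) Q
    omega
  · intro q hq
    rcases Finset.mem_insert.1 hq with rfl | hq
    · exact ⟨hx, hy⟩
    rcases Finset.mem_insert.1 hq with rfl | hq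
    · exact ⟨hy, hz⟩
    · exact ⟨(Finset.mem_sdiff.1 (hQR q hq).1).1, (Finset.mem_sdiff.1 (hQR q hq).2).1⟩
  · intro w hw
    rcases hmem w hw with hw | rfl | rfl | rfl
    · obtain ⟨q, hq, h⟩ := hcov w hw
      exact ⟨q, by simp [hq], h⟩
    · exact ⟨(w, y), by simp, by simp⟩
    · exact ⟨(x, w), by simp, by simp⟩
    · exact ⟨(y, w), by simp, by simp⟩
  · have hxyQ : (x, y) ∈ insert (x, y) (insert (y, z) Q) := by simp
    have hyzQ : (y, z) ∈ insert (x, y) (insert (y, z) Q) := by simp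
    have hQin : ∀ q ∈ Q, q ∈ insert (x, y) (insert (y, z) Q) := fun q hq => by simp [hq]
    intro w hw w' hw' hne
    rcases hmem w hw with h | h <;> rcases hmem w' hw' with h' | h'
    · obtain ⟨q, hq, hs⟩ := hsep w h w' h' hne
      exact ⟨q, hQin q hq, hs⟩
    · obtain ⟨q, hq, hs⟩ := hcov w h
      exact ⟨q, hQin q hq, Or.inl ⟨hs, hQ' q hq w' h'⟩⟩
    · obtain ⟨q, hq, hs⟩ := hcov w' h'
      exact ⟨q, hQin q hq, Or.inr ⟨hQ' q hq w h, hs⟩⟩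
    · rcases h with rfl | rfl | rfl <;> rcases h' with rfl | rfl | rfl
      · exact absurd rfl hne
      · exact ⟨_, hyzQ, Or.inr ⟨by simp [hxy, hxz], by simp⟩⟩
      · exact ⟨_, hxyQ, Or.inl ⟨by simp, by simp [hxz.symm, hyz.symm]⟩⟩
      · exact ⟨_, hyzQ, Or.inl ⟨by simp, by simp [hxy, hxz]⟩⟩
      · exact absurd rfl hne
      · exact ⟨_, hxyQ, Or.inl ⟨by simp, by simp [hxz.symm, hyz.symm]⟩⟩
      · exact ⟨_, hxyQ, Or.inr ⟨by simp [hxz.symm, hyz.symm], by simp⟩⟩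
      · exact ⟨_, hxyQ, Or.inr ⟨by simp [hxz.symm, hyz.symm], by simp⟩⟩
      · exact absurd rfl hne

end Enumeration

section Leaves

variable {V : Type*} {T : SimpleGraph V}

lemma onPath_two_edges_iff (hT : T.IsTree) {u x v w : V} (h1 : T.Adj u x) (h2 : T.Adj x v)
    (huv : u ≠ v) : OnPath T u v w ↔ w = u ∨ w = x ∨ w = v := by
  have hp : (Walk.cons h1 h2.toWalk).IsPath := by
    simp [Walk.cons_isPath_iff, h2.ne, h1.ne, huv]
  rw [onPath_iff hT hp]
  simp

/-- A family of pairs of vertices whose paths separate and cover all vertices bounds `spathC`. -/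
lemma spathC_le_card (hT : T.IsTree) (Q : Finset (V × V))
    (hsep : ∀ x y, x ≠ y → ∃ q ∈ Q, (OnPath T q.1 q.2 x ∧ ¬ OnPath T q.1 q.2 y) ∨
      (¬ OnPath T q.1 q.2 x ∧ OnPath T q.1 q.2 y))
    (hcov : ∀ x, ∃ q ∈ Q, OnPath T q.1 q.2 x) : spathC T (vertexElems T) ≤ Q.card := by
  classical
  choose p hp using fun q : V × V => exists_isPath hT q.1 q.2
  let f : V × V → AnyPath T := fun q => ⟨q.1, q.2, p q, hp q⟩
  have hf : ∀ q w, Contains (f q) (Sum.inl w) ↔ OnPath T q.1 q.2 w := fun q w =>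
    (onPath_iff hT (hp q)).symm
  refine le_trans (Nat.sInf_le ⟨Q.image f, ?_, ?_, rfl⟩) Finset.card_image_le
  · rintro _ ⟨x, rfl⟩ _ ⟨y, rfl⟩ hne
    obtain ⟨q, hq, h⟩ := hsep x y (fun h => hne (by rw [h]))
    refine ⟨f q, Finset.mem_image_of_mem _ hq, ?_⟩
    rwa [hf, hf]
  · rintro _ ⟨x, rfl⟩
    obtain ⟨q, hq, h⟩ := hcov x
    exact ⟨f q, Finset.mem_image_of_mem _ hq, (hf q x).2 h⟩

variable [Fintype V] [DecidableRel T.Adj]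

open Classical in
/-- The support vertices: those adjacent to a leaf. -/
noncomputable def supports (T : SimpleGraph V) [DecidableRel T.Adj] : Finset V :=
  Finset.univ.filter fun s => ∃ l, T.Adj s l ∧ T.degree l = 1

lemma mem_supports {s : V} : s ∈ supports T ↔ ∃ l, T.Adj s l ∧ T.degree l = 1 := by
  simp [supports]

lemma eq_of_adj_leaf {l s s' : V} (hl : T.degree l = 1) (h : T.Adj s l) (h' : T.Adj s' l) :
    s = s' := by
  obtain ⟨t, -, ht⟩ := (T.degree_eq_one_iff_existsUnique_adj).1 hl
  rw [ht s h.symm, ht s' h'.symm]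

/-- A leaf on a path is one of its extremes. -/
lemma OnPath.eq_of_leaf {u v l : V} (h : OnPath T u v l) (hl : T.degree l = 1) :
    l = u ∨ l = v := by
  obtain ⟨p, hp, hlp⟩ := h
  by_contra hcon
  push Not at hcon
  have := two_le_degree_inner hp hlp hcon.1 hcon.2
  omega

/-- A path starting at a leaf runs through the neighbour of the leaf. -/
lemma onPath_of_leaf (hT : T.IsTree) {l s v : V} (hl : T.degree l = 1) (h : T.Adj s l)
    (hv : v ≠ l) : OnPath T l v s := by
  obtain ⟨p, hp⟩ := exists_isPath hT l v
  have hnil : ¬ p.Nil := Walk.not_nil_of_ne hv.symm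
  have := eq_of_adj_leaf hl h (p.adj_snd hnil).symm
  exact ⟨p, hp, this ▸ p.getVert_mem_support 1⟩

lemma Par.eq_of_leaf {r l s z : V} (hl : T.degree l = 1) (h : Par T r s l)
    (h' : T.Adj l z) : z = s := (eq_of_adj_leaf hl h.1 h'.symm).symm

/-- A vertex of degree at least three other than the root has two children. -/
lemma exists_two_children (hT : T.IsTree) {r x : V} (hx : x ≠ r) (hd : 3 ≤ T.degree x) :
    ∃ c d, Par T r x c ∧ Par T r x d ∧ c ≠ d := by
  classical
  obtain ⟨p, hp⟩ := exists_par hT hx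
  have h1 : 1 < ((T.neighborFinset x).erase p).card := by
    rw [Finset.card_erase_of_mem (by simpa using hp.1.symm), card_neighborFinset_eq_degree]
    omega
  obtain ⟨c, hc, d, hd, hcd⟩ := Finset.one_lt_card.1 h1
  have key : ∀ c ∈ (T.neighborFinset x).erase p, Par T r x c := by
    intro c hc
    obtain ⟨hne, hc⟩ := Finset.mem_erase.1 hc
    rw [mem_neighborFinset] at hc
    exact (par_or_par hT hc).resolve_right fun h => hne (h.unique hT hp)
  exact ⟨c, d, key c hc, key d hd, hcd⟩

/-- A vertex of degree two other than the root has exactly one child. -/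
lemma existsUnique_child (hT : T.IsTree) {r x : V} (hx : x ≠ r) (hd : T.degree x = 2) :
    ∃ c, Par T r x c ∧ ∀ d, Par T r x d → d = c := by
  classical
  obtain ⟨p, hp⟩ := exists_par hT hx
  have h1 : ((T.neighborFinset x).erase p).card = 1 := by
    rw [Finset.card_erase_of_mem (by simpa using hp.1.symm), card_neighborFinset_eq_degree, hd]
  obtain ⟨c, hc⟩ := Finset.card_eq_one.1 h1
  have hmem : ∀ d, d ∈ (T.neighborFinset x).erase p ↔ d = c := fun d => by rw [hc]; simp
  refine ⟨c, ?_, fun d hd => ?_⟩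
  · obtain ⟨hne, h⟩ := Finset.mem_erase.1 ((hmem c).2 rfl)
    rw [mem_neighborFinset] at h
    exact (par_or_par hT h).resolve_right fun h => hne (h.unique hT hp)
  · refine (hmem d).1 (Finset.mem_erase.2 ⟨?_, by simpa using hd.1⟩)
    rintro rfl
    exact hp.not_anc hT hd.2

/-- The descendants of a vertex that is neither the root nor a leaf include a support vertex. -/
lemma exists_support_anc (hT : T.IsTree) {r z : V} (hz : z ≠ r) (hd : T.degree z ≠ 1) :
    ∃ s ∈ supports T, Anc T r z s := by
  classical
  obtain ⟨ord, hinj, hmono, -⟩ := exists_preorder hT r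
  -- the last descendant of `z` in preorder is a leaf
  obtain ⟨w, hw, hmax⟩ := (Finset.univ.filter fun w => Anc T r z w).exists_max_image ord
    ⟨z, by simpa using anc_refl hT z⟩
  simp only [Finset.mem_filter, Finset.mem_univ, true_and] at hw hmax
  have hwr : w ≠ r := by
    rintro rfl
    exact hz (hw.antisymm hT (anc_root hT z))
  obtain ⟨s, hs⟩ := exists_par hT hwr
  have hleaf : T.degree w = 1 := by
    rw [degree_eq_one_iff_existsUnique_adj]
    refine ⟨s, hs.1.symm, fun y hy => ?_⟩
    rcases par_or_par (r := r) hT hy with h | h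
    · have h1 := hmax y (hw.trans hT h.2)
      have h2 := hinj (h1.antisymm (hmono _ _ h.2))
      exact absurd h2 h.1.ne'
    · exact h.unique hT hs
  refine ⟨s, mem_supports.2 ⟨w, hs.1, hleaf⟩, ?_⟩
  refine ((hs.anc_iff hT).1 hw).resolve_left ?_
  rintro rfl
  exact hd hleaf

/-- A leaf and its neighbour have the same ancestors among the vertices that are neither leaves
nor adjacent to the root. -/
lemma anc_leaf_iff (hT : T.IsTree) {r z s l : V} (hr : T.degree r = 1) (hz : T.degree z ≠ 1)
    (hzr : ¬ T.Adj r z) (h : T.Adj s l) (hl : T.degree l = 1) : Anc T r z l ↔ Anc T r z s := by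
  rcases par_or_par (r := r) hT h with h' | h'
  · rw [h'.anc_iff hT]
    refine or_iff_right ?_
    rintro rfl
    exact hz hl
  · have hlr : l = r := by
      by_contra hne
      obtain ⟨p, hp⟩ := exists_par hT hne
      have := hp.eq_of_leaf hl h'.1
      exact h'.not_anc hT (this ▸ hp.2)
    subst hlr
    rw [h'.anc_iff hT]
    refine (or_iff_right ?_).symm
    rintro rfl
    exact hzr h'.1

end Leaves

/-! ### Linking the support vertices cyclically -/

section LeafFrame

variable {V : Type*} {T : SimpleGraph V} [Fintype V] [DecidableRel T.Adj]

/-- The data for the construction: a leaf `r` as the root, a depth-first preorder `ord`, three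
marked leaves `a s`, `b s`, `c s` at each support vertex `s`, and a cyclic enumeration `τ` of the
support vertices in preorder, with successor function `nx`. -/
structure LeafFrame (T : SimpleGraph V) [DecidableRel T.Adj] where
  isTree : T.IsTree
  r : V
  degree_r : T.degree r = 1
  ord : V → ℕ
  ord_inj : ord.Injective
  ord_mono : ∀ x y, Anc T r x y → ord x ≤ ord y
  ord_convex : ∀ y u v w, Anc T r y u → Anc T r y w → ord u ≤ ord v → ord v ≤ ord w → Anc T r y v
  a : V → V
  b : V → V
  c : V → V
  adj_a : ∀ s ∈ supports T, T.Adj s (a s)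
  adj_b : ∀ s ∈ supports T, T.Adj s (b s)
  adj_c : ∀ s ∈ supports T, T.Adj s (c s)
  degree_a : ∀ s ∈ supports T, T.degree (a s) = 1
  degree_b : ∀ s ∈ supports T, T.degree (b s) = 1
  degree_c : ∀ s ∈ supports T, T.degree (c s) = 1
  a_ne_b : ∀ s ∈ supports T, a s ≠ b s
  a_ne_c : ∀ s ∈ supports T, a s ≠ c s
  b_ne_c : ∀ s ∈ supports T, b s ≠ c s
  τ : ℕ → V
  nx : V → V
  τ_mem : ∀ n, τ n ∈ supports T
  τ_add : ∀ n, τ (n + (supports T).card) = τ n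
  τ_surj : ∀ s ∈ supports T, ∃ n < (supports T).card, τ n = s
  τ_mono : ∀ i j, i < j → j < (supports T).card → ord (τ i) < ord (τ j)
  τ_succ : ∀ n, τ (n + 1) = nx (τ n)

/-- A frame exists once every support vertex has three leaves to mark. -/
lemma exists_leafFrame [Nontrivial V] (hT : T.IsTree)
    (h3 : ∀ s ∈ supports T, 3 ≤ ((T.neighborFinset s).filter fun l => T.degree l = 1).card) :
    Nonempty (LeafFrame T) := by
  classical
  obtain ⟨r, hr⟩ := hT.exists_vert_degree_one_of_nontrivial
  obtain ⟨ord, ord_inj, ord_mono, ord_convex⟩ := exists_preorder hT r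
  have hne : (supports T).Nonempty := by
    obtain ⟨s, hs, -⟩ := (T.degree_eq_one_iff_existsUnique_adj).1 hr
    exact ⟨s, mem_supports.2 ⟨r, hs.symm, hr⟩⟩
  obtain ⟨τ, nx, h1, h2, h4, h5, h6⟩ := exists_cyclic_enumeration hne ord_inj
  have h7 : ∀ s, ∃ x y z, s ∈ supports T → (T.Adj s x ∧ T.degree x = 1) ∧
      (T.Adj s y ∧ T.degree y = 1) ∧ (T.Adj s z ∧ T.degree z = 1) ∧ x ≠ y ∧ x ≠ z ∧ y ≠ z := by
    intro s
    by_cases hs : s ∈ supports T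
    · obtain ⟨x, hx, y, hy, z, hz, h⟩ := Finset.two_lt_card.1 (h3 s hs)
      simp only [Finset.mem_filter, mem_neighborFinset] at hx hy hz
      exact ⟨x, y, z, fun _ => ⟨hx, hy, hz, h⟩⟩
    · exact ⟨s, s, s, fun h => absurd h hs⟩
  choose a b c habc using h7
  exact ⟨{ isTree := hT, r := r, degree_r := hr, ord := ord, ord_inj := ord_inj,
           ord_mono := ord_mono, ord_convex := ord_convex, a := a, b := b, c := c,
           adj_a := fun s hs => (habc s hs).1.1
           adj_b := fun s hs => (habc s hs).2.1.1
           adj_c := fun s hs => (habc s hs).2.2.1.1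
           degree_a := fun s hs => (habc s hs).1.2
           degree_b := fun s hs => (habc s hs).2.1.2
           degree_c := fun s hs => (habc s hs).2.2.1.2
           a_ne_b := fun s hs => (habc s hs).2.2.2.1
           a_ne_c := fun s hs => (habc s hs).2.2.2.2.1
           b_ne_c := fun s hs => (habc s hs).2.2.2.2.2
           τ := τ, nx := nx, τ_mem := h1, τ_add := h2, τ_surj := h4, τ_mono := h5,
           τ_succ := h6 }⟩

namespace LeafFrame

variable (F : LeafFrame T)

open Classical in
/-- The basic pairs of leaves: `(a s, b s)` and `(b s, c (nx s))` for each support vertex `s`. -/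
noncomputable def basePairs : Finset (V × V) :=
  ((supports T).image fun s => (F.a s, F.b s)) ∪ (supports T).image fun s => (F.b s, F.c (F.nx s))

lemma card_basePairs_le : F.basePairs.card ≤ 2 * (supports T).card := by
  classical
  have h1 := Finset.card_union_le ((supports T).image fun s => (F.a s, F.b s))
    ((supports T).image fun s => (F.b s, F.c (F.nx s)))
  have h2 := Finset.card_image_le (s := supports T) (f := fun s => (F.a s, F.b s))
  have h3 := Finset.card_image_le (s := supports T) (f := fun s => (F.b s, F.c (F.nx s)))
  rw [basePairs]
  omega

lemma inner_mem {s : V} (hs : s ∈ supports T) : (F.a s, F.b s) ∈ F.basePairs := by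
  classical
  exact Finset.mem_union_left _ (Finset.mem_image_of_mem _ hs)

/-- The pair of leaves that links consecutive support vertices. -/
def link (n : ℕ) : V × V := (F.b (F.τ n), F.c (F.τ (n + 1)))

lemma link_mem (n : ℕ) : F.link n ∈ F.basePairs := by
  classical
  rw [link, F.τ_succ]
  exact Finset.mem_union_right _ (Finset.mem_image_of_mem (fun s => (F.b s, F.c (F.nx s)))
    (F.τ_mem n))

lemma three_le_degree (F : LeafFrame T) {s : V} (hs : s ∈ supports T) : 3 ≤ T.degree s := by
  classical
  rw [← card_neighborFinset_eq_degree]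
  refine Finset.two_lt_card.2 ⟨F.a s, by simpa using F.adj_a s hs, F.b s,
    by simpa using F.adj_b s hs, F.c s, by simpa using F.adj_c s hs, F.a_ne_b s hs,
    F.a_ne_c s hs, F.b_ne_c s hs⟩

/-- The cyclic enumeration leaves any proper subset of the support vertices. -/
lemma exists_exit (A : V → Prop) {s t : V} (hs : s ∈ supports T) (ht : t ∈ supports T)
    (hAs : A s) (hAt : ¬ A t) : ∃ n, A (F.τ n) ∧ ¬ A (F.τ (n + 1)) := by
  obtain ⟨i, hi, rfl⟩ := F.τ_surj s hs
  obtain ⟨j, hj, rfl⟩ := F.τ_surj t ht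
  obtain ⟨n, -, -, h⟩ := exists_step (P := fun n => A (F.τ n)) (p := i)
    (q := j + (supports T).card) (by omega) hAs (by rwa [F.τ_add])
  exact ⟨n, h⟩

lemma exists_change (P : V → Prop) {i j : ℕ} (hij : i ≤ j)
    (h : ¬ (P (F.τ i) ↔ P (F.τ j))) :
    ∃ n, i ≤ n ∧ n < j ∧ ¬ (P (F.τ n) ↔ P (F.τ (n + 1))) := by
  obtain ⟨n, h1, h2, h3, h4⟩ := exists_step (P := fun n => (P (F.τ i) ↔ P (F.τ n))) hij Iff.rfl h
  exact ⟨n, h1, h2, by tauto⟩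

/-- If `K` is convex in the preorder, and `P` is not constant on the support vertices in `K`, then
`P` changes between two consecutive ones. -/
lemma exists_change_of_convex (K P : V → Prop)
    (hK : ∀ x y z, K x → K z → F.ord x ≤ F.ord y → F.ord y ≤ F.ord z → K y) {s t : V}
    (hs : s ∈ supports T) (ht : t ∈ supports T) (hKs : K s) (hKt : K t) (hP : ¬ (P s ↔ P t)) :
    ∃ n, K (F.τ n) ∧ K (F.τ (n + 1)) ∧ ¬ (P (F.τ n) ↔ P (F.τ (n + 1))) := by
  obtain ⟨i, hi, rfl⟩ := F.τ_surj s hs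
  obtain ⟨j, hj, rfl⟩ := F.τ_surj t ht
  have hle : ∀ i j, i ≤ j → j < (supports T).card → F.ord (F.τ i) ≤ F.ord (F.τ j) := by
    intro i j hij hj
    rcases hij.lt_or_eq with h | h
    · exact (F.τ_mono i j h hj).le
    · rw [h]
  have main : ∀ i j, i ≤ j → j < (supports T).card → K (F.τ i) → K (F.τ j) →
      ¬ (P (F.τ i) ↔ P (F.τ j)) →
      ∃ n, K (F.τ n) ∧ K (F.τ (n + 1)) ∧ ¬ (P (F.τ n) ↔ P (F.τ (n + 1))) := by
    intro i j hij hj hKi hKj hP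
    obtain ⟨n, h1, h2, h3⟩ := F.exists_change P hij hP
    exact ⟨n, hK _ _ _ hKi hKj (hle i n h1 (by omega)) (hle n j h2.le hj),
      hK _ _ _ hKi hKj (hle i (n + 1) (by omega) (by omega)) (hle (n + 1) j h2 hj), h3⟩
  rcases le_total i j with h | h
  · exact main i j h hj hKs hKt hP
  · exact main j i h hi hKt hKs (fun h => hP h.symm)

/-- The same if the complement of `K` is convex: one may have to go around the cycle. -/
lemma exists_change_of_coconvex (K P : V → Prop)
    (hK : ∀ x y z, ¬ K x → ¬ K z → F.ord x ≤ F.ord y → F.ord y ≤ F.ord z → ¬ K y) {s t : V}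
    (hs : s ∈ supports T) (ht : t ∈ supports T) (hKs : K s) (hKt : K t) (hP : ¬ (P s ↔ P t)) :
    ∃ n, K (F.τ n) ∧ K (F.τ (n + 1)) ∧ ¬ (P (F.τ n) ↔ P (F.τ (n + 1))) := by
  obtain ⟨i, hi, rfl⟩ := F.τ_surj s hs
  obtain ⟨j, hj, rfl⟩ := F.τ_surj t ht
  have main : ∀ i j, i < j → j < (supports T).card → K (F.τ i) → K (F.τ j) →
      ¬ (P (F.τ i) ↔ P (F.τ j)) →
      ∃ n, K (F.τ n) ∧ K (F.τ (n + 1)) ∧ ¬ (P (F.τ n) ↔ P (F.τ (n + 1))) := by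
    intro i j hij hj hKi hKj hP
    by_cases hall : ∀ n, i ≤ n → n ≤ j → K (F.τ n)
    · obtain ⟨n, h1, h2, h3⟩ := F.exists_change P hij.le hP
      exact ⟨n, hall n h1 h2.le, hall (n + 1) (by omega) h2, h3⟩
    push Not at hall
    obtain ⟨z, hz1, hz2, hKz⟩ := hall
    have hzi : i < z := lt_of_le_of_ne hz1 (by rintro rfl; exact hKz hKi)
    have hzj : z < j := lt_of_le_of_ne hz2 (by rintro rfl; exact hKz hKj)
    have hall' : ∀ n, j ≤ n → n ≤ i + (supports T).card → K (F.τ n) := by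
      intro n h1 h2
      rcases lt_or_ge n (supports T).card with hn | hn
      · rcases h1.lt_or_eq with h1 | h1
        · by_contra hKn
          exact hK _ _ _ hKz hKn (F.τ_mono z j hzj hj).le (F.τ_mono j n h1 hn).le hKj
        · rwa [← h1]
      · obtain ⟨k, rfl⟩ := Nat.exists_eq_add_of_le' hn
        rw [F.τ_add]
        rcases (show k ≤ i by omega).lt_or_eq with h | h
        · by_contra hKn
          exact hK _ _ _ hKn hKz (F.τ_mono k i h (by omega)).le
            (F.τ_mono i z hzi (by omega)).le hKi
        · rwa [h]
    obtain ⟨n, h1, h2, h3⟩ := F.exists_change P (i := j) (j := i + (supports T).card) (by omega)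
      (by rw [F.τ_add]; exact fun h => hP h.symm)
    exact ⟨n, hall' n h1 h2.le, hall' (n + 1) (by omega) h2, h3⟩
  rcases lt_trichotomy i j with h | h | h
  · exact main i j h hj hKs hKt hP
  · exact absurd (by rw [h]) hP
  · exact main j i h hi hKt hKs (fun h => hP h.symm)

lemma ne_root {z : V} (hz : T.degree z ≠ 1) : z ≠ F.r := by
  rintro rfl
  exact hz F.degree_r

lemma not_adj_root {z : V} (hz : z ∉ supports T) : ¬ T.Adj F.r z := fun h =>
  hz (mem_supports.2 ⟨F.r, h.symm, F.degree_r⟩)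

lemma anc_b_iff {z s : V} (hz : T.degree z ≠ 1) (hzr : ¬ T.Adj F.r z) (hs : s ∈ supports T) :
    Anc T F.r z (F.b s) ↔ Anc T F.r z s :=
  anc_leaf_iff F.isTree F.degree_r hz hzr (F.adj_b s hs) (F.degree_b s hs)

lemma anc_c_iff {z s : V} (hz : T.degree z ≠ 1) (hzr : ¬ T.Adj F.r z) (hs : s ∈ supports T) :
    Anc T F.r z (F.c s) ↔ Anc T F.r z s :=
  anc_leaf_iff F.isTree F.degree_r hz hzr (F.adj_c s hs) (F.degree_c s hs)

/-- A link between support vertices on different sides of the edge from `x` down to `z` runs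
through that edge. -/
lemma onPath_link {x z : V} (h : Par T F.r x z) (hz : T.degree z ≠ 1) (hzr : ¬ T.Adj F.r z)
    {n : ℕ} (hn : ¬ (Anc T F.r z (F.τ n) ↔ Anc T F.r z (F.τ (n + 1)))) :
    OnPath T (F.link n).1 (F.link n).2 x ∧ OnPath T (F.link n).1 (F.link n).2 z := by
  have h1 := F.anc_b_iff hz hzr (F.τ_mem n)
  have h2 := F.anc_c_iff hz hzr (F.τ_mem (n + 1))
  by_cases h3 : Anc T F.r z (F.τ n)
  · exact h.onPath_of_anc F.isTree (h1.2 h3) (fun h4 => hn (by tauto))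
  · have h4 := h.onPath_of_anc F.isTree (u := F.c (F.τ (n + 1))) (v := F.b (F.τ n))
      (h2.2 (by tauto)) (by tauto)
    exact ⟨h4.1.symm, h4.2.symm⟩

lemma not_onPath_link_of_not_anc {y z : V} (hz : T.degree z ≠ 1) (hzr : ¬ T.Adj F.r z) {n : ℕ}
    (h1 : ¬ Anc T F.r z (F.τ n)) (h2 : ¬ Anc T F.r z (F.τ (n + 1))) (hy : Anc T F.r z y) :
    ¬ OnPath T (F.link n).1 (F.link n).2 y := fun h =>
  h.not_anc F.isTree (mt (F.anc_b_iff hz hzr (F.τ_mem n)).1 h1)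
    (mt (F.anc_c_iff hz hzr (F.τ_mem (n + 1))).1 h2) hy

lemma not_onPath_link_of_anc {y z : V} (hz : T.degree z ≠ 1) (hzr : ¬ T.Adj F.r z) {n : ℕ}
    (h1 : Anc T F.r z (F.τ n)) (h2 : Anc T F.r z (F.τ (n + 1))) (hy : ¬ Anc T F.r z y) :
    ¬ OnPath T (F.link n).1 (F.link n).2 y := fun h =>
  hy (h.anc F.isTree ((F.anc_b_iff hz hzr (F.τ_mem n)).2 h1)
    ((F.anc_c_iff hz hzr (F.τ_mem (n + 1))).2 h2))

/-- The neighbour of the root is a support vertex that does not descend from `z`, unless `z` is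
the root or its neighbour. -/
lemma exists_support_not_anc : ∃ s ∈ supports T, ∀ z, z ≠ F.r → ¬ T.Adj F.r z →
    ¬ Anc T F.r z s := by
  obtain ⟨s, hs, -⟩ := (T.degree_eq_one_iff_existsUnique_adj).1 F.degree_r
  have hpar : Par T F.r F.r s := ⟨hs, anc_root F.isTree s⟩
  refine ⟨s, mem_supports.2 ⟨F.r, hs.symm, F.degree_r⟩, fun z hz hzr h => ?_⟩
  rcases (hpar.anc_iff F.isTree).1 h with rfl | h
  · exact hzr hs
  · exact hz (h.antisymm F.isTree (anc_root F.isTree z))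

lemma not_adj_root_of_par {x z : V} (hx : x ≠ F.r) (h : Par T F.r x z) : ¬ T.Adj F.r z := by
  intro hz
  exact hx (h.unique F.isTree ⟨hz, anc_root F.isTree z⟩)

/-- A support vertex is separated from every other vertex by a basic pair. -/
lemma separates_support (hbig : ∀ s, ∃ t ∈ supports T, t ≠ s) {x y : V} (hx : x ∈ supports T)
    (hxy : y ≠ x) : ∃ q ∈ F.basePairs, OnPath T q.1 q.2 x ∧ ¬ OnPath T q.1 q.2 y := by
  have hT := F.isTree
  have hab := onPath_two_edges_iff hT (F.adj_a x hx).symm (F.adj_b x hx) (F.a_ne_b x hx) (w := y)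
  by_cases hya : y = F.a x
  · obtain ⟨n, hn⟩ : ∃ n, F.τ n = x := (F.τ_surj x hx).imp fun _ h => h.2
    have hne : F.b x ≠ F.c (F.τ (n + 1)) := by
      intro h
      have h1 := eq_of_adj_leaf (F.degree_b x hx) (F.adj_b x hx)
        (h ▸ F.adj_c _ (F.τ_mem (n + 1)))
      rw [← h1] at h
      exact F.b_ne_c x hx h
    refine ⟨F.link n, F.link_mem n, ?_, ?_⟩
    · rw [link, hn]
      exact onPath_of_leaf hT (F.degree_b x hx) (F.adj_b x hx) hne.symm
    · rw [link, hn, hya]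
      intro h
      rcases h.eq_of_leaf (F.degree_a x hx) with h | h
      · exact F.a_ne_b x hx h
      · have h : F.a x = F.c (F.τ (n + 1)) := h
        have h1 := eq_of_adj_leaf (F.degree_a x hx) (F.adj_a x hx)
          (h ▸ F.adj_c _ (F.τ_mem (n + 1)))
        rw [← h1] at h
        exact F.a_ne_c x hx h
  by_cases hyb : y = F.b x
  · obtain ⟨t, ht, htx⟩ := hbig x
    obtain ⟨n, h1, h2⟩ := F.exists_exit (fun z => z ≠ x) ht hx htx (by simp)
    have h2 : F.τ (n + 1) = x := not_not.1 h2
    have hbb : F.b (F.τ n) ≠ F.b x := fun h => h1 (eq_of_adj_leaf (F.degree_b x hx)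
      (h ▸ F.adj_b _ (F.τ_mem n)) (F.adj_b x hx))
    have hbc : F.b (F.τ n) ≠ F.c x := fun h => h1 (eq_of_adj_leaf (F.degree_c x hx)
      (h ▸ F.adj_b _ (F.τ_mem n)) (F.adj_c x hx))
    refine ⟨F.link n, F.link_mem n, ?_, ?_⟩
    · rw [link, h2]
      exact (onPath_of_leaf hT (F.degree_c x hx) (F.adj_c x hx) hbc).symm
    · rw [link, h2, hyb]
      intro h
      rcases h.eq_of_leaf (F.degree_b x hx) with h | h
      · exact hbb h.symm
      · exact F.b_ne_c x hx h
  · exact ⟨_, F.inner_mem hx, (onPath_two_edges_iff hT (F.adj_a x hx).symm (F.adj_b x hx)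
      (F.a_ne_b x hx)).2 (Or.inr (Or.inl rfl)), by rw [hab]; tauto⟩

/-- A vertex of degree at least three is separated from every other vertex by a basic pair. If it
is not a support vertex, then one of the links joins two of its branches that do not contain
the other vertex. -/
lemma separates_three_le (hbig : ∀ s, ∃ t ∈ supports T, t ≠ s) {x y : V} (hx : 3 ≤ T.degree x)
    (hxy : y ≠ x) : ∃ q ∈ F.basePairs, OnPath T q.1 q.2 x ∧ ¬ OnPath T q.1 q.2 y := by
  by_cases hxs : x ∈ supports T
  · exact F.separates_support hbig hxs hxy
  have hT := F.isTree
  have hxr : x ≠ F.r := F.ne_root (by omega)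
  have child_deg : ∀ z, Par T F.r x z → T.degree z ≠ 1 := fun z hz h =>
    hxs (mem_supports.2 ⟨z, hz.1, h⟩)
  have hdisj : ∀ z z' w, Par T F.r x z → Par T F.r x z' → z ≠ z' → Anc T F.r z w →
      ¬ Anc T F.r z' w := by
    intro z z' w hz hz' hne h h'
    rcases h.total hT h' with h1 | h1
    · rcases (hz'.anc_iff hT).1 h1 with h2 | h2
      · exact hne h2
      · exact hz.not_anc hT h2
    · rcases (hz.anc_iff hT).1 h1 with h2 | h2
      · exact hne h2.symm
      · exact hz'.not_anc hT h2
  by_cases hy : Anc T F.r x y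
  · obtain ⟨z, hz, hzy⟩ := hy.exists_child hT hxy.symm
    obtain ⟨z', hz', hne⟩ : ∃ z', Par T F.r x z' ∧ z ≠ z' := by
      obtain ⟨z1, z2, h1, h2, h12⟩ := exists_two_children hT hxr hx
      by_cases h : z = z1
      · exact ⟨z2, h2, h ▸ h12⟩
      · exact ⟨z1, h1, h⟩
    have hzr := F.not_adj_root_of_par hxr hz
    have hzr' := F.not_adj_root_of_par hxr hz'
    obtain ⟨s, hs, hs'⟩ := exists_support_anc hT (F.ne_root (child_deg z' hz')) (child_deg z' hz')
    obtain ⟨t, ht, ht'⟩ := F.exists_support_not_anc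
    obtain ⟨n, h1, h2, h3⟩ := F.exists_change_of_coconvex (fun w => ¬ Anc T F.r z w)
      (fun w => Anc T F.r z' w)
      (fun u v w hu hw huv hvw => not_not.2
        (F.ord_convex z u v w (not_not.1 hu) (not_not.1 hw) huv hvw)) hs ht
      (hdisj z' z s hz' hz hne.symm hs')
      (ht' z (F.ne_root (child_deg z hz)) hzr)
      (fun h => ht' z' (F.ne_root (child_deg z' hz')) hzr' (h.1 hs'))
    exact ⟨F.link n, F.link_mem n, (F.onPath_link hz' (child_deg z' hz') hzr' h3).1,
      F.not_onPath_link_of_not_anc (child_deg z hz) hzr h1 h2 hzy⟩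
  · obtain ⟨z, z', hz, hz', hne⟩ := exists_two_children hT hxr hx
    have hzr := F.not_adj_root_of_par hxr hz
    obtain ⟨s, hs, hs'⟩ := exists_support_anc hT (F.ne_root (child_deg z hz)) (child_deg z hz)
    obtain ⟨t, ht, ht'⟩ := exists_support_anc hT (F.ne_root (child_deg z' hz')) (child_deg z' hz')
    obtain ⟨n, h1, h2, h3⟩ := F.exists_change_of_convex (fun w => Anc T F.r x w)
      (fun w => Anc T F.r z w) (fun u v w => F.ord_convex x u v w) hs ht
      (hz.2.trans hT hs') (hz'.2.trans hT ht')
      (fun h => hdisj z' z t hz' hz hne.symm ht' (h.1 hs'))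
    exact ⟨F.link n, F.link_mem n, (F.onPath_link hz (child_deg z hz) hzr h3).1,
      F.not_onPath_link_of_anc (by omega) (F.not_adj_root hxs) h1 h2 hy⟩

lemma not_support_of_degree_two (F : LeafFrame T) {m : V} (hm : T.degree m = 2) :
    m ∉ supports T := fun h => by
  have := F.three_le_degree h
  omega

/-- Two links cross the edge above a vertex of degree two, one in each direction. -/
lemma exists_links_of_degree_two {m : V} (hm : T.degree m = 2) :
    ∃ i j, (Anc T F.r m (F.τ i) ∧ ¬ Anc T F.r m (F.τ (i + 1))) ∧
      (¬ Anc T F.r m (F.τ j) ∧ Anc T F.r m (F.τ (j + 1))) ∧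
      OnPath T (F.link i).1 (F.link i).2 m ∧ OnPath T (F.link j).1 (F.link j).2 m := by
  have hm1 : T.degree m ≠ 1 := by omega
  have hmr := F.not_adj_root (F.not_support_of_degree_two hm)
  obtain ⟨s, hs, hs'⟩ := exists_support_anc F.isTree (F.ne_root hm1) hm1
  obtain ⟨t, ht, ht'⟩ := F.exists_support_not_anc
  have ht' := ht' m (F.ne_root hm1) hmr
  obtain ⟨x, hx⟩ := exists_par F.isTree (F.ne_root hm1)
  obtain ⟨i, hi⟩ := F.exists_exit (fun w => Anc T F.r m w) hs ht hs' ht'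
  obtain ⟨j, hj1, hj2⟩ := F.exists_exit (fun w => ¬ Anc T F.r m w) ht hs ht' (not_not.2 hs')
  rw [not_not] at hj2
  exact ⟨i, j, hi, ⟨hj1, hj2⟩, (F.onPath_link hx hm1 hmr (by tauto)).2,
    (F.onPath_link hx hm1 hmr (by tauto)).2⟩

/-- No leaf lies on two links crossing the same edge in opposite directions. -/
lemma separates_leaf_degree_two {l m : V} (hl : T.degree l = 1) (hm : T.degree m = 2) :
    ∃ q ∈ F.basePairs, OnPath T q.1 q.2 m ∧ ¬ OnPath T q.1 q.2 l := by
  obtain ⟨i, j, ⟨hi1, hi2⟩, ⟨hj1, hj2⟩, hi, hj⟩ := F.exists_links_of_degree_two hm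
  by_contra hcon
  push Not at hcon
  have h1 := (hcon _ (F.link_mem i) hi).eq_of_leaf hl
  have h2 := (hcon _ (F.link_mem j) hj).eq_of_leaf hl
  simp only [link] at h1 h2
  have key : ∀ s s', s ∈ supports T → s' ∈ supports T → F.b s = F.c s' → False := by
    intro s s' hs hs' h
    have := eq_of_adj_leaf (F.degree_b s hs) (F.adj_b s hs) (h ▸ F.adj_c s' hs')
    rw [← this] at h
    exact F.b_ne_c s hs h
  rcases h1 with rfl | rfl
  · rcases h2 with h2 | h2
    · have := eq_of_adj_leaf hl (F.adj_b _ (F.τ_mem i)) (h2 ▸ F.adj_b _ (F.τ_mem j))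
      exact hj1 (this ▸ hi1)
    · exact key _ _ (F.τ_mem i) (F.τ_mem (j + 1)) h2
  · rcases h2 with h2 | h2
    · exact key _ _ (F.τ_mem j) (F.τ_mem (i + 1)) h2.symm
    · have := eq_of_adj_leaf hl (F.adj_c _ (F.τ_mem (i + 1))) (h2 ▸ F.adj_c _ (F.τ_mem (j + 1)))
      exact hi2 (this ▸ hj2)

/-- `m'` descends from `m`, and all vertices from `m` to `m'` have degree two. -/
def Chain (m m' : V) : Prop :=
  Anc T F.r m m' ∧ ∀ z, Anc T F.r m z → Anc T F.r z m' → T.degree z = 2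

lemma separates_of_anc {m m' : V} (hm : T.degree m = 2) (hm' : T.degree m' = 2) (hne : m ≠ m')
    (h : Anc T F.r m m') (hc : ¬ F.Chain m m') :
    ∃ q ∈ F.basePairs, (OnPath T q.1 q.2 m ∧ ¬ OnPath T q.1 q.2 m') ∨
      (¬ OnPath T q.1 q.2 m ∧ OnPath T q.1 q.2 m') := by
  have hT := F.isTree
  have hm1 : T.degree m ≠ 1 := by omega
  have hm1' : T.degree m' ≠ 1 := by omega
  have hms := F.not_support_of_degree_two hm
  have hmr := F.not_adj_root hms
  have hmr' := F.not_adj_root (F.not_support_of_degree_two hm')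
  -- the part of the tree between `m` and `m'` contains a support vertex
  obtain ⟨s, hs, hs1, hs2⟩ : ∃ s ∈ supports T, Anc T F.r m s ∧ ¬ Anc T F.r m' s := by
    obtain ⟨x, hx1, hx2, hx3⟩ : ∃ x, Anc T F.r m x ∧ Anc T F.r x m' ∧ T.degree x ≠ 2 := by
      by_contra hcon
      push Not at hcon
      exact hc ⟨h, hcon⟩
    have hxm : x ≠ m := by rintro rfl; exact hx3 hm
    have hxm' : x ≠ m' := by rintro rfl; exact hx3 hm'
    have hxr : x ≠ F.r := by
      rintro rfl
      exact hxm ((anc_root hT m).antisymm hT hx1)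
    by_cases hxs : x ∈ supports T
    · exact ⟨x, hxs, hx1, fun h => hxm' (hx2.antisymm hT h)⟩
    obtain ⟨z, hz, hzm'⟩ := hx2.exists_child hT hxm'
    have hx4 : 3 ≤ T.degree x := by
      obtain ⟨y, hy⟩ := exists_par hT hxr
      have hyz : y ≠ z := by
        rintro rfl
        exact hy.not_anc hT hz.2
      have : 1 < (T.neighborFinset x).card :=
        Finset.one_lt_card.2 ⟨y, by simpa using hy.1.symm, z, by simpa using hz.1, hyz⟩
      rw [card_neighborFinset_eq_degree] at this
      omega
    obtain ⟨z', hz', hzz'⟩ : ∃ z', Par T F.r x z' ∧ z ≠ z' := by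
      obtain ⟨z1, z2, h1, h2, h12⟩ := exists_two_children hT hxr hx4
      by_cases h : z = z1
      · exact ⟨z2, h2, h ▸ h12⟩
      · exact ⟨z1, h1, h⟩
    have hd : T.degree z' ≠ 1 := fun h => hxs (mem_supports.2 ⟨z', hz'.1, h⟩)
    obtain ⟨s, hs, hs'⟩ := exists_support_anc hT (F.ne_root hd) hd
    refine ⟨s, hs, hx1.trans hT (hz'.2.trans hT hs'), fun h => ?_⟩
    rcases (hzm'.trans hT h).total hT hs' with h1 | h1
    · rcases (hz'.anc_iff hT).1 h1 with h2 | h2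
      · exact hzz' h2
      · exact hz.not_anc hT h2
    · rcases (hz.anc_iff hT).1 h1 with h2 | h2
      · exact hzz' h2.symm
      · exact hz'.not_anc hT h2
  obtain ⟨t, ht, ht'⟩ := F.exists_support_not_anc
  have ht' := ht' m (F.ne_root hm1) hmr
  obtain ⟨n, ⟨h1, h2⟩, h3⟩ := F.exists_exit
    (fun w => Anc T F.r m w ∧ ¬ Anc T F.r m' w) hs ht ⟨hs1, hs2⟩ (fun h => ht' h.1)
  refine ⟨F.link n, F.link_mem n, ?_⟩
  by_cases h4 : Anc T F.r m (F.τ (n + 1))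
  · right
    have h5 : Anc T F.r m' (F.τ (n + 1)) := by tauto
    obtain ⟨x', hx'⟩ := exists_par hT (F.ne_root hm1')
    refine ⟨?_, (F.onPath_link hx' hm1' hmr' (by tauto)).2⟩
    -- both ends of the link descend from the only child of `m`
    obtain ⟨z, hz, huniq⟩ := existsUnique_child hT (F.ne_root hm1) hm
    have hzd : T.degree z ≠ 1 := fun h => hms (mem_supports.2 ⟨z, hz.1, h⟩)
    have hzr := F.not_adj_root_of_par (F.ne_root hm1) hz
    have below : ∀ k, Anc T F.r m (F.τ k) → Anc T F.r z (F.τ k) := by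
      intro k hk
      obtain ⟨d, hd, hdk⟩ := hk.exists_child hT (fun h => hms (h ▸ F.τ_mem k))
      rwa [huniq d hd] at hdk
    exact F.not_onPath_link_of_anc hzd hzr (below n h1) (below _ h4) (hz.not_anc hT)
  · left
    obtain ⟨x, hx⟩ := exists_par hT (F.ne_root hm1)
    refine ⟨(F.onPath_link hx hm1 hmr (by tauto)).2, ?_⟩
    exact F.not_onPath_link_of_not_anc hm1' hmr' h2 (fun h5 => h4 (h.trans hT h5))
      (anc_refl hT m')

/-- Two vertices of degree two with a vertex of another degree between them are separated by a
basic pair. -/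
lemma separates_degree_two {m m' : V} (hm : T.degree m = 2) (hm' : T.degree m' = 2) (hne : m ≠ m')
    (hc : ¬ F.Chain m m') (hc' : ¬ F.Chain m' m) :
    ∃ q ∈ F.basePairs, (OnPath T q.1 q.2 m ∧ ¬ OnPath T q.1 q.2 m') ∨
      (¬ OnPath T q.1 q.2 m ∧ OnPath T q.1 q.2 m') := by
  by_cases h : Anc T F.r m m'
  · exact F.separates_of_anc hm hm' hne h hc
  by_cases h' : Anc T F.r m' m
  · obtain ⟨q, hq, hs⟩ := F.separates_of_anc hm' hm hne.symm h' hc'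
    exact ⟨q, hq, by tauto⟩
  have hT := F.isTree
  have hm1 : T.degree m ≠ 1 := by omega
  have hm1' : T.degree m' ≠ 1 := by omega
  have hmr := F.not_adj_root (F.not_support_of_degree_two hm)
  have hmr' := F.not_adj_root (F.not_support_of_degree_two hm')
  have hdisj : ∀ w, Anc T F.r m w → ¬ Anc T F.r m' w := by
    intro w h1 h2
    rcases h1.total hT h2 with h3 | h3
    · exact h h3
    · exact h' h3
  obtain ⟨s, hs, hs'⟩ := exists_support_anc hT (F.ne_root hm1) hm1
  obtain ⟨t, ht, ht'⟩ := F.exists_support_not_anc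
  obtain ⟨n, ⟨h1, h2⟩, h3⟩ := F.exists_exit
    (fun w => ¬ Anc T F.r m w ∧ ¬ Anc T F.r m' w) ht hs
    ⟨ht' m (F.ne_root hm1) hmr, ht' m' (F.ne_root hm1') hmr'⟩ (fun h => h.1 hs')
  refine ⟨F.link n, F.link_mem n, ?_⟩
  by_cases h4 : Anc T F.r m (F.τ (n + 1))
  · left
    obtain ⟨x, hx⟩ := exists_par hT (F.ne_root hm1)
    exact ⟨(F.onPath_link hx hm1 hmr (by tauto)).2,
      F.not_onPath_link_of_not_anc hm1' hmr' h2 (hdisj _ h4) (anc_refl hT m')⟩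
  · right
    obtain ⟨x, hx⟩ := exists_par hT (F.ne_root hm1')
    exact ⟨F.not_onPath_link_of_not_anc hm1 hmr h1 h4 (anc_refl hT m),
      (F.onPath_link hx hm1' hmr' (by tauto)).2⟩

end LeafFrame

end LeafFrame

/-! ### Separating the vertices inside bare paths -/

section Gaps

/-- If the members of `{0, …, M - 1}` are paired at distance `M / 2 + 1`, then no nonempty interval
is closed under the pairing; a number without a partner counts as not closed. -/
lemma exists_unpaired {M : ℕ} (I : ℕ → Prop) (hI : ∀ i, I i → i < M)
    (hconv : ∀ i j k, I i → I k → i ≤ j → j ≤ k → I j) {k : ℕ} (hk : I k) :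
    ∃ i < M / 2 + 1, (i + (M / 2 + 1) < M ∧ I i ∧ ¬ I (i + (M / 2 + 1))) ∨
      (i + (M / 2 + 1) < M ∧ ¬ I i ∧ I (i + (M / 2 + 1))) ∨
      (M ≤ i + (M / 2 + 1) ∧ I i) := by
  generalize hh : M / 2 + 1 = h
  have h1 := hI k hk
  by_contra hcon
  push Not at hcon
  have hmid : I (h - 1) := by
    by_cases hkh : h ≤ k
    · obtain ⟨j, rfl⟩ := Nat.exists_eq_add_of_le' hkh
      have hj : I j := by
        by_contra hj
        exact (hcon j (by omega)).2.1 h1 hj hk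
      exact hconv j (h - 1) (j + h) hj hk (by omega) (by omega)
    · have h2 := hcon k (by omega)
      by_cases h3 : M ≤ k + h
      · exact absurd hk (h2.2.2 h3)
      · exact hconv k (h - 1) (k + h) hk (h2.1 (by omega) hk) (by omega) (by omega)
  exact (hcon (h - 1) (by omega)).2.2 (by omega) hmid

variable {V : Type*} {T : SimpleGraph V} [Fintype V] [DecidableRel T.Adj]

namespace LeafFrame

variable (F : LeafFrame T)

open Classical in
/-- The lower endpoints of the edges joining two vertices of degree two. -/
noncomputable def gaps : Finset V :=
  Finset.univ.filter fun g => T.degree g = 2 ∧ ∃ x, Par T F.r x g ∧ T.degree x = 2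

lemma card_gaps_le : F.gaps.card ≤ (midEdges T).card := by
  classical
  have h : ∀ g, ∃ x, g ∈ F.gaps → T.degree g = 2 ∧ Par T F.r x g ∧ T.degree x = 2 := by
    intro g
    by_cases hg : g ∈ F.gaps
    · obtain ⟨h1, x, h2⟩ := (Finset.mem_filter.1 hg).2
      exact ⟨x, fun _ => ⟨h1, h2⟩⟩
    · exact ⟨g, fun h => absurd h hg⟩
  choose p hp using h
  refine Finset.card_le_card_of_injOn (fun g => s(p g, g)) ?_ ?_
  · intro g hg
    obtain ⟨h1, h2, h3⟩ := hp g hg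
    simp only [midEdges, Finset.coe_filter, Set.mem_ofPred_eq, mem_edgeFinset, mem_edgeSet]
    refine ⟨h2.1, fun v hv => ?_⟩
    rcases Sym2.mem_iff.1 hv with rfl | rfl <;> assumption
  · intro g hg g' hg' h
    rcases Sym2.eq_iff.1 h with ⟨-, h⟩ | ⟨h1, h2⟩
    · exact h
    · have h3 := (hp g hg).2.1.2
      have h4 := (hp g' hg').2.1.2
      rw [h1] at h3
      rw [← h2] at h4
      exact h4.antisymm F.isTree h3

variable {F}

/-- The lower endpoints of the edges between `m` and `m'`. -/
def Below (F : LeafFrame T) (m m' g : V) : Prop := Anc T F.r m g ∧ g ≠ m ∧ Anc T F.r g m'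

lemma Below.mem_gaps {m m' g : V} (hc : F.Chain m m') (h : F.Below m m' g) : g ∈ F.gaps := by
  classical
  obtain ⟨h1, h2, h3⟩ := h
  have hg := hc.2 g h1 h3
  obtain ⟨x, hx⟩ := exists_par F.isTree (F.ne_root (z := g) (by omega))
  have hmx := ((hx.anc_iff F.isTree).1 h1).resolve_left h2.symm
  exact Finset.mem_filter.2 ⟨Finset.mem_univ _, hg, x, hx, hc.2 x hmx (hx.2.trans F.isTree h3)⟩

/-- Below a chain the tree does not branch before the end of the chain. -/
lemma Chain.comparable {m m' g w : V} (hc : F.Chain m m') (hg : Anc T F.r g m')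
    (hw : Anc T F.r m w) : Anc T F.r w g ∨ Anc T F.r g w := by
  classical
  have hT := F.isTree
  -- the last vertex of the chain above `w`
  obtain ⟨z, hz, hmax⟩ := (Finset.univ.filter fun z =>
    Anc T F.r m z ∧ Anc T F.r z m' ∧ Anc T F.r z w).exists_max_image F.ord
    ⟨m, by simpa using ⟨anc_refl hT m, hc.1, hw⟩⟩
  simp only [Finset.mem_filter, Finset.mem_univ, true_and] at hz hmax
  obtain ⟨h1, h2, h3⟩ := hz
  by_cases hzm : z = m'
  · exact Or.inr (hg.trans hT (hzm ▸ h3))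
  by_cases hzw : z = w
  · exact (hzw ▸ h2).total hT hg
  exfalso
  have hdeg := hc.2 z h1 h2
  obtain ⟨d, hd, hdm⟩ := h2.exists_child hT hzm
  obtain ⟨d', hd', hdw⟩ := h3.exists_child hT hzw
  obtain ⟨e, -, he⟩ := existsUnique_child hT (F.ne_root (z := z) (by omega)) hdeg
  rw [he d' hd', ← he d hd] at hdw
  have h4 := hmax d ⟨h1.trans hT hd.2, hdm, hdw⟩
  exact hd.1.ne (F.ord_inj ((F.ord_mono _ _ hd.2).antisymm h4))

lemma Chain.exists_par {m m' : V} (hc : F.Chain m m') :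
    (∃ x, Par T F.r x m) ∧ ∃ x, Par T F.r x m' := by
  have h1 := hc.2 m (anc_refl F.isTree m) hc.1
  have h2 := hc.2 m' hc.1 (anc_refl F.isTree m')
  exact ⟨PathSeparation.exists_par F.isTree (F.ne_root (by omega)),
    PathSeparation.exists_par F.isTree (F.ne_root (by omega))⟩

/-- A path from the upper end of an edge of the chain to the upper end of an edge in another branch
separates the ends of the chain. -/
lemma Chain.separates_of_incomparable {m m' g g' x x' : V} (hc : F.Chain m m')
    (hg : F.Below m m' g) (h1 : ¬ Anc T F.r g g') (h2 : ¬ Anc T F.r g' g) (hx : Par T F.r x g)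
    (hx' : Par T F.r x' g') : OnPath T x x' m ∧ ¬ OnPath T x x' m' := by
  have hT := F.isTree
  obtain ⟨y, hy⟩ := hc.exists_par.1
  have hmx : Anc T F.r m x := ((hx.anc_iff hT).1 hg.1).resolve_left hg.2.1.symm
  refine ⟨(hy.onPath_of_anc hT hmx fun h => ?_).2, fun h => ?_⟩
  · rcases hc.comparable hg.2.2 (h.trans hT hx'.2) with h3 | h3
    · exact h2 h3
    · exact h1 h3
  · exact h.not_anc hT (fun h => hx.not_anc hT (hg.2.2.trans hT h))
      (fun h => h1 (hg.2.2.trans hT (h.trans hT hx'.2))) (anc_refl hT m')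

/-- A path from the lower end of an edge of the chain down to the upper end of an edge below the
chain separates the ends of the chain. -/
lemma Chain.separates_of_above {m m' g g' x' : V} (hc : F.Chain m m')
    (hg : F.Below m m' g) (hg' : ¬ F.Below m m' g') (h : Anc T F.r g g') (hne : g ≠ g')
    (hx' : Par T F.r x' g') : ¬ OnPath T g x' m ∧ OnPath T g x' m' := by
  have hT := F.isTree
  have hgx : Anc T F.r g x' := ((hx'.anc_iff hT).1 h).resolve_left hne
  have hmg : ¬ Anc T F.r g m := fun h => hg.2.1 (h.antisymm hT hg.1)
  refine ⟨fun h => hmg (h.anc hT (anc_refl hT g) hgx), ?_⟩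
  have h1 : ¬ Anc T F.r g' m' := fun h1 =>
    hg' ⟨hg.1.trans hT h, by rintro rfl; exact hmg h, h1⟩
  have h2 := (hc.comparable (anc_refl hT m') (hg.1.trans hT h)).resolve_left h1
  have h3 : Anc T F.r m' x' := ((hx'.anc_iff hT).1 h2).resolve_left
    (by rintro rfl; exact h1 (anc_refl hT _))
  by_cases h4 : g = m'
  · rw [← h4]; exact onPath_left hT g x'
  · obtain ⟨y, hy⟩ := hc.exists_par.2
    exact (hy.onPath_of_anc hT h3 fun h => h4 (hg.2.2.antisymm hT h)).2.symm

/-- A path from the lower end of an edge above the chain down to the upper end of an edge of the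
chain separates the ends of the chain. -/
lemma Chain.separates_of_below {m m' g g' x' : V} (hc : F.Chain m m') (hmm : m ≠ m')
    (hg : ¬ F.Below m m' g) (hg' : F.Below m m' g') (h : Anc T F.r g g')
    (hx' : Par T F.r x' g') : OnPath T g x' m ∧ ¬ OnPath T g x' m' := by
  have hT := F.isTree
  have hgm : Anc T F.r g m := by
    rcases h.total hT hg'.1 with h1 | h1
    · exact h1
    · by_contra h2
      exact hg ⟨h1, by rintro rfl; exact h2 (anc_refl hT _), h.trans hT hg'.2.2⟩
  have hmx : Anc T F.r m x' := ((hx'.anc_iff hT).1 hg'.1).resolve_left hg'.2.1.symm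
  constructor
  · by_cases h4 : g = m
    · rw [← h4]; exact onPath_left hT g x'
    · obtain ⟨y, hy⟩ := hc.exists_par.1
      exact (hy.onPath_of_anc hT hmx fun h => h4 (hgm.antisymm hT h)).2.symm
  · intro h1
    refine h1.not_anc hT (fun h2 => hmm ?_) (fun h2 => hx'.not_anc hT (hg'.2.2.trans hT h2))
      (anc_refl hT m')
    exact hc.1.antisymm hT (h2.trans hT hgm)

/-- A path from the root to the upper end of an edge of the chain separates the ends of the
chain. -/
lemma Below.separates_of_root {m m' g x : V} (hg : F.Below m m' g)
    (hx : Par T F.r x g) : OnPath T F.r x m ∧ ¬ OnPath T F.r x m' :=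
  ⟨((hx.anc_iff F.isTree).1 hg.1).resolve_left hg.2.1.symm,
    fun h => hx.not_anc F.isTree (hg.2.2.trans F.isTree h)⟩

variable (F)

/-- The ends of every chain are separated by a family of at most `#gaps / 2 + 1` pairs: the gaps,
numbered in preorder, are paired at distance `#gaps / 2 + 1`. The gaps of a chain are consecutive,
so some pair has exactly one member among them. -/
lemma exists_pairs_separating_chains : ∃ Q : Finset (V × V), Q.card ≤ F.gaps.card / 2 + 1 ∧
    ∀ m m', m ≠ m' → F.Chain m m' → ∃ q ∈ Q, (OnPath T q.1 q.2 m ∧ ¬ OnPath T q.1 q.2 m') ∨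
      (¬ OnPath T q.1 q.2 m ∧ OnPath T q.1 q.2 m') := by
  classical
  have hT := F.isTree
  rcases F.gaps.eq_empty_or_nonempty with h0 | hne
  · refine ⟨∅, by simp, fun m m' hmm hc => ?_⟩
    have : F.Below m m' m' := ⟨hc.1, hmm.symm, anc_refl hT m'⟩
    have := this.mem_gaps hc
    simp [h0] at this
  obtain ⟨γ, -, hγ, -, hsurj, hmono, -⟩ := exists_cyclic_enumeration hne F.ord_inj
  set M := F.gaps.card with hM
  have hpar : ∀ n, ∃ x, Par T F.r x (γ n) := fun n => by
    obtain ⟨-, x, hx, -⟩ := (Finset.mem_filter.1 (hγ n)).2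
    exact ⟨x, hx⟩
  choose p hp using hpar
  let h := M / 2 + 1
  let f : ℕ → V × V := fun i =>
    if i + h < M then
      if Anc T F.r (γ i) (γ (i + h)) then (γ i, p (i + h)) else (p i, p (i + h))
    else (F.r, p i)
  refine ⟨(Finset.range h).image f, Finset.card_image_le.trans (by simp [h]), ?_⟩
  intro m m' hmm hc
  have hle : ∀ i j, i ≤ j → j < M → F.ord (γ i) ≤ F.ord (γ j) := by
    intro i j hij hj
    rcases hij.lt_or_eq with h | h
    · exact (hmono i j h hj).le
    · rw [h]
  obtain ⟨k, hk, hkm⟩ := hsurj m' (Below.mem_gaps hc ⟨hc.1, hmm.symm, anc_refl hT m'⟩)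
  obtain ⟨i, hi, hcase⟩ := exists_unpaired (M := M) (fun i => i < M ∧ F.Below m m' (γ i))
    (fun i hi => hi.1) (by
      rintro i j k ⟨hi, hi'⟩ ⟨hk, hk'⟩ hij hjk
      have hj : j < M := by omega
      refine ⟨hj, ?_⟩
      have h1 : Anc T F.r m (γ j) :=
        F.ord_convex m _ _ _ hi'.1 hk'.1 (hle i j hij hj) (hle j k hjk hk)
      refine ⟨h1, ?_, ?_⟩
      · rintro h2
        have h3 := F.ord_mono _ _ hi'.1
        rw [← h2] at h3
        exact hi'.2.1 ((F.ord_inj (h3.antisymm (hle i j hij hj))).symm.trans h2)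
      · rcases hc.comparable hk'.2.2 h1 with h2 | h2
        · exact h2.trans hT hk'.2.2
        · rw [F.ord_inj ((hle j k hjk hk).antisymm (F.ord_mono _ _ h2))]
          exact hk'.2.2)
    (k := k) ⟨hk, by rw [hkm]; exact ⟨hc.1, hmm.symm, anc_refl hT m'⟩⟩
  refine ⟨f i, Finset.mem_image_of_mem f (Finset.mem_range.2 hi), ?_⟩
  change (i + h < M ∧ _) ∨ (i + h < M ∧ _) ∨ (M ≤ i + h ∧ _) at hcase
  rcases hcase with ⟨hlt, ⟨-, h1⟩, h2⟩ | ⟨hlt, h1, -, h2⟩ | ⟨hlt, -, h1⟩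
  · have h2 : ¬ F.Below m m' (γ (i + h)) := fun h3 => h2 ⟨hlt, h3⟩
    have hord := hmono i (i + h) (by omega) hlt
    by_cases hanc : Anc T F.r (γ i) (γ (i + h))
    · simp only [f, if_pos hlt, if_pos hanc]
      exact Or.inr (hc.separates_of_above h1 h2 hanc (fun h => by rw [h] at hord; omega) (hp _))
    · simp only [f, if_pos hlt, if_neg hanc]
      refine Or.inl (hc.separates_of_incomparable h1 hanc (fun h => ?_) (hp _) (hp _))
      exact absurd (F.ord_mono _ _ h) (not_le.2 hord)
  · have h1 : ¬ F.Below m m' (γ i) := fun h3 => h1 ⟨by omega, h3⟩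
    have hord := hmono i (i + h) (by omega) hlt
    by_cases hanc : Anc T F.r (γ i) (γ (i + h))
    · simp only [f, if_pos hlt, if_pos hanc]
      exact Or.inl (hc.separates_of_below hmm h1 h2 hanc (hp _))
    · simp only [f, if_pos hlt, if_neg hanc]
      have h3 := hc.separates_of_incomparable h2 (fun h => absurd (F.ord_mono _ _ h)
        (not_le.2 hord)) hanc (hp (i + h)) (hp i)
      exact Or.inl ⟨h3.1.symm, fun h => h3.2 h.symm⟩
  · simp only [f, if_neg (not_lt.2 hlt)]
    exact Or.inl (h1.separates_of_root (hp _))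

end LeafFrame

end Gaps

/-! ### The upper bound -/

section UpperBound

variable {V : Type*} {T : SimpleGraph V} [Fintype V] [DecidableRel T.Adj]

namespace LeafFrame

variable (F : LeafFrame T)

open Classical in
/-- The leaves that occur in the basic pairs. -/
noncomputable def marked : Finset V :=
  (supports T).image F.a ∪ (supports T).image F.b ∪ (supports T).image F.c

lemma mem_marked {l : V} :
    l ∈ F.marked ↔ ∃ s ∈ supports T, l = F.a s ∨ l = F.b s ∨ l = F.c s := by
  classical
  simp only [marked, Finset.mem_union, Finset.mem_image]
  constructor
  · rintro ((⟨s, hs, rfl⟩ | ⟨s, hs, rfl⟩) | ⟨s, hs, rfl⟩)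
    · exact ⟨s, hs, Or.inl rfl⟩
    · exact ⟨s, hs, Or.inr (Or.inl rfl)⟩
    · exact ⟨s, hs, Or.inr (Or.inr rfl)⟩
  · rintro ⟨s, hs, rfl | rfl | rfl⟩
    · exact Or.inl (Or.inl ⟨s, hs, rfl⟩)
    · exact Or.inl (Or.inr ⟨s, hs, rfl⟩)
    · exact Or.inr ⟨s, hs, rfl⟩

lemma marked_subset : F.marked ⊆ leaves T := by
  intro l hl
  rw [mem_leaves]
  obtain ⟨s, hs, rfl | rfl | rfl⟩ := F.mem_marked.1 hl
  · exact F.degree_a s hs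
  · exact F.degree_b s hs
  · exact F.degree_c s hs

variable {F} {s s' : V}

lemma a_inj (hs : s ∈ supports T) (hs' : s' ∈ supports T) (h : F.a s = F.a s') : s = s' :=
  eq_of_adj_leaf (F.degree_a s hs) (F.adj_a s hs) (h ▸ F.adj_a s' hs')

lemma b_inj (hs : s ∈ supports T) (hs' : s' ∈ supports T) (h : F.b s = F.b s') : s = s' :=
  eq_of_adj_leaf (F.degree_b s hs) (F.adj_b s hs) (h ▸ F.adj_b s' hs')

lemma c_inj (hs : s ∈ supports T) (hs' : s' ∈ supports T) (h : F.c s = F.c s') : s = s' :=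
  eq_of_adj_leaf (F.degree_c s hs) (F.adj_c s hs) (h ▸ F.adj_c s' hs')

lemma a_ne_b' (hs : s ∈ supports T) (hs' : s' ∈ supports T) : F.a s ≠ F.b s' := by
  intro h
  have := eq_of_adj_leaf (F.degree_a s hs) (F.adj_a s hs) (h ▸ F.adj_b s' hs')
  rw [← this] at h
  exact F.a_ne_b s hs h

lemma a_ne_c' (hs : s ∈ supports T) (hs' : s' ∈ supports T) : F.a s ≠ F.c s' := by
  intro h
  have := eq_of_adj_leaf (F.degree_a s hs) (F.adj_a s hs) (h ▸ F.adj_c s' hs')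
  rw [← this] at h
  exact F.a_ne_c s hs h

lemma b_ne_c' (hs : s ∈ supports T) (hs' : s' ∈ supports T) : F.b s ≠ F.c s' := by
  intro h
  have := eq_of_adj_leaf (F.degree_b s hs) (F.adj_b s hs) (h ▸ F.adj_c s' hs')
  rw [← this] at h
  exact F.b_ne_c s hs h

variable (F)

lemma card_marked : F.marked.card = 3 * (supports T).card := by
  classical
  have h1 : Disjoint ((supports T).image F.a) ((supports T).image F.b) := by
    rw [Finset.disjoint_left]
    rintro _ h1 h2
    obtain ⟨s, hs, rfl⟩ := Finset.mem_image.1 h1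
    obtain ⟨s', hs', h⟩ := Finset.mem_image.1 h2
    exact a_ne_b' hs hs' h.symm
  have h2 : Disjoint ((supports T).image F.a ∪ (supports T).image F.b)
      ((supports T).image F.c) := by
    rw [Finset.disjoint_left]
    rintro _ h1 h2
    obtain ⟨s', hs', rfl⟩ := Finset.mem_image.1 h2
    rcases Finset.mem_union.1 h1 with h1 | h1
    · obtain ⟨s, hs, h⟩ := Finset.mem_image.1 h1
      exact a_ne_c' hs hs' h
    · obtain ⟨s, hs, h⟩ := Finset.mem_image.1 h1
      exact b_ne_c' hs hs' h
  rw [marked, Finset.card_union_of_disjoint h2, Finset.card_union_of_disjoint h1,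
    Finset.card_image_of_injOn fun s hs s' hs' h => a_inj hs hs' h,
    Finset.card_image_of_injOn fun s hs s' hs' h => b_inj hs hs' h,
    Finset.card_image_of_injOn fun s hs s' hs' h => c_inj hs hs' h]
  ring

lemma onPath_pair_iff_of_leaf (F : LeafFrame T) {q : V × V} {l : V} (hl : T.degree l = 1) :
    OnPath T q.1 q.2 l ↔ l = q.1 ∨ l = q.2 := by
  refine ⟨fun h => h.eq_of_leaf hl, ?_⟩
  rintro (rfl | rfl)
  · exact onPath_left F.isTree _ _
  · exact onPath_right F.isTree _ _

lemma basePairs_marked {q : V × V} (hq : q ∈ F.basePairs) : q.1 ∈ F.marked ∧ q.2 ∈ F.marked := by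
  classical
  rcases Finset.mem_union.1 hq with h | h
  · obtain ⟨s, hs, rfl⟩ := Finset.mem_image.1 h
    exact ⟨F.mem_marked.2 ⟨s, hs, by simp⟩, F.mem_marked.2 ⟨s, hs, by simp⟩⟩
  · obtain ⟨s, hs, rfl⟩ := Finset.mem_image.1 h
    obtain ⟨n, -, rfl⟩ := F.τ_surj s hs
    rw [← F.τ_succ]
    exact ⟨F.mem_marked.2 ⟨_, F.τ_mem n, by simp⟩, F.mem_marked.2 ⟨_, F.τ_mem (n + 1), by simp⟩⟩

lemma exists_next_eq {s : V} (hs : s ∈ supports T) : ∃ n, F.τ (n + 1) = s := by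
  obtain ⟨n, hn, rfl⟩ := F.τ_surj s hs
  refine ⟨n + (supports T).card - 1, ?_⟩
  rw [show n + (supports T).card - 1 + 1 = n + (supports T).card by omega, F.τ_add]

/-- Marked leaves at `s` occur in the following basic pairs: `a s` in one, `b s` in two of which one
is shared with `a s`, and `c s` in one, shared with some `b t`. -/
lemma separates_marked {l l' : V} (hl : l ∈ F.marked) (hl' : l' ∈ F.marked) (hne : l ≠ l') :
    ∃ q ∈ F.basePairs, ((l = q.1 ∨ l = q.2) ∧ ¬ (l' = q.1 ∨ l' = q.2)) ∨
      (¬ (l = q.1 ∨ l = q.2) ∧ (l' = q.1 ∨ l' = q.2)) := by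
  obtain ⟨s, hs, h⟩ := F.mem_marked.1 hl
  obtain ⟨s', hs', h'⟩ := F.mem_marked.1 hl'
  have link_b : ∀ s ∈ supports T, ∃ n, F.link n = (F.b s, F.c (F.τ (n + 1))) := by
    intro s hs
    obtain ⟨n, -, hn⟩ := F.τ_surj s hs
    exact ⟨n, by rw [link, hn]⟩
  have hab : ∀ s s', s ∈ supports T → s' ∈ supports T → ∃ q ∈ F.basePairs,
      ((F.a s = q.1 ∨ F.a s = q.2) ∧ ¬ (F.b s' = q.1 ∨ F.b s' = q.2)) ∨
      (¬ (F.a s = q.1 ∨ F.a s = q.2) ∧ (F.b s' = q.1 ∨ F.b s' = q.2)) := by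
    intro s s' hs hs'
    by_cases hss : s = s'
    · subst hss
      obtain ⟨n, hn⟩ := link_b s hs
      refine ⟨F.link n, F.link_mem n, Or.inr ?_⟩
      rw [hn]
      refine ⟨?_, Or.inl rfl⟩
      rintro (h | h)
      · exact F.a_ne_b s hs h
      · exact a_ne_c' hs (F.τ_mem _) h
    · refine ⟨_, F.inner_mem hs, Or.inl ⟨Or.inl rfl, ?_⟩⟩
      rintro (h | h)
      · exact a_ne_b' hs hs' h.symm
      · exact hss (b_inj hs hs' h.symm)
  rcases h with rfl | rfl | rfl <;> rcases h' with rfl | rfl | rfl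
  · refine ⟨_, F.inner_mem hs, Or.inl ⟨Or.inl rfl, ?_⟩⟩
    rintro (h | h)
    · exact hne h.symm
    · exact a_ne_b' hs' hs h
  · exact hab s s' hs hs'
  · refine ⟨_, F.inner_mem hs, Or.inl ⟨Or.inl rfl, ?_⟩⟩
    rintro (h | h)
    · exact a_ne_c' hs hs' h.symm
    · exact b_ne_c' hs hs' h.symm
  · obtain ⟨q, hq, h⟩ := hab s' s hs' hs
    exact ⟨q, hq, by tauto⟩
  · refine ⟨_, F.inner_mem hs, Or.inl ⟨Or.inr rfl, ?_⟩⟩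
    rintro (h | h)
    · exact a_ne_b' hs hs' h.symm
    · exact hne h.symm
  · refine ⟨_, F.inner_mem hs, Or.inl ⟨Or.inr rfl, ?_⟩⟩
    rintro (h | h)
    · exact a_ne_c' hs hs' h.symm
    · exact b_ne_c' hs hs' h.symm
  · refine ⟨_, F.inner_mem hs', Or.inr ⟨?_, Or.inl rfl⟩⟩
    rintro (h | h)
    · exact a_ne_c' hs' hs h.symm
    · exact b_ne_c' hs' hs h.symm
  · refine ⟨_, F.inner_mem hs', Or.inr ⟨?_, Or.inr rfl⟩⟩
    rintro (h | h)
    · exact a_ne_c' hs' hs h.symm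
    · exact b_ne_c' hs' hs h.symm
  · obtain ⟨n, hn⟩ := F.exists_next_eq hs
    refine ⟨F.link n, F.link_mem n, Or.inl ?_⟩
    rw [link, hn]
    refine ⟨Or.inr rfl, ?_⟩
    rintro (h | h)
    · exact b_ne_c' (F.τ_mem n) hs' h.symm
    · exact hne h.symm

lemma marked_covered {l : V} (hl : l ∈ F.marked) :
    ∃ q ∈ F.basePairs, l = q.1 ∨ l = q.2 := by
  obtain ⟨s, hs, rfl | rfl | rfl⟩ := F.mem_marked.1 hl
  · exact ⟨_, F.inner_mem hs, Or.inl rfl⟩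
  · exact ⟨_, F.inner_mem hs, Or.inr rfl⟩
  · obtain ⟨n, hn⟩ := F.exists_next_eq hs
    exact ⟨_, F.link_mem n, Or.inr (by rw [link, hn])⟩

/-- The basic pairs extend to a family of at most `⌈2 h₁ / 3⌉` pairs of leaves that separates and
covers the leaves. -/
lemma exists_leafPairs : ∃ Q : Finset (V × V), F.basePairs ⊆ Q ∧
    3 * Q.card ≤ 2 * (leaves T).card + 2 ∧
    (∀ l, T.degree l = 1 → ∃ q ∈ Q, OnPath T q.1 q.2 l) ∧
    ∀ l l', T.degree l = 1 → T.degree l' = 1 → l ≠ l' →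
      ∃ q ∈ Q, (OnPath T q.1 q.2 l ∧ ¬ OnPath T q.1 q.2 l') ∨
        (¬ OnPath T q.1 q.2 l ∧ OnPath T q.1 q.2 l') := by
  classical
  obtain ⟨Q, hQ, hQR, hcov, hsep⟩ := exists_pairs_separating (leaves T \ F.marked)
  have hmem : ∀ l, T.degree l = 1 → l ∈ F.marked ∨ l ∈ leaves T \ F.marked := by
    intro l hl
    rw [Finset.mem_sdiff, mem_leaves]
    tauto
  have hout : ∀ l ∈ leaves T \ F.marked, ∀ q ∈ F.basePairs, ¬ (l = q.1 ∨ l = q.2) := by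
    rintro l hl q hq (rfl | rfl)
    · exact (Finset.mem_sdiff.1 hl).2 (F.basePairs_marked hq).1
    · exact (Finset.mem_sdiff.1 hl).2 (F.basePairs_marked hq).2
  refine ⟨F.basePairs ∪ Q, Finset.subset_union_left, ?_, ?_, ?_⟩
  · have h1 := Finset.card_union_le F.basePairs Q
    have h2 := F.card_basePairs_le
    have h3 := Finset.card_sdiff_add_card_eq_card F.marked_subset
    rw [F.card_marked] at h3
    omega
  · intro l hl
    simp only [F.onPath_pair_iff_of_leaf hl]
    rcases hmem l hl with h | h
    · obtain ⟨q, hq, h⟩ := F.marked_covered h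
      exact ⟨q, Finset.mem_union_left _ hq, h⟩
    · obtain ⟨q, hq, h⟩ := hcov l h
      exact ⟨q, Finset.mem_union_right _ hq, h⟩
  · intro l l' hl hl' hne
    simp only [F.onPath_pair_iff_of_leaf hl, F.onPath_pair_iff_of_leaf hl']
    rcases hmem l hl with h | h <;> rcases hmem l' hl' with h' | h'
    · obtain ⟨q, hq, hs⟩ := F.separates_marked h h' hne
      exact ⟨q, Finset.mem_union_left _ hq, hs⟩
    · obtain ⟨q, hq, hs⟩ := F.marked_covered h
      exact ⟨q, Finset.mem_union_left _ hq, Or.inl ⟨hs, hout l' h' q hq⟩⟩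
    · obtain ⟨q, hq, hs⟩ := F.marked_covered h'
      exact ⟨q, Finset.mem_union_left _ hq, Or.inr ⟨hout l h q hq, hs⟩⟩
    · obtain ⟨q, hq, hs⟩ := hsep l h l' h' hne
      exact ⟨q, Finset.mem_union_right _ hq, hs⟩

lemma exists_adj (F : LeafFrame T) (v : V) : ∃ w, T.Adj v w := by
  by_cases hv : v = F.r
  · obtain ⟨s, hs, -⟩ := (T.degree_eq_one_iff_existsUnique_adj).1 F.degree_r
    exact ⟨s, hv ▸ hs⟩
  · obtain ⟨x, hx⟩ := exists_par F.isTree hv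
    exact ⟨x, hx.1.symm⟩

lemma degree_cases (F : LeafFrame T) (v : V) :
    T.degree v = 1 ∨ T.degree v = 2 ∨ 3 ≤ T.degree v := by
  have : 0 < T.degree v := (T.degree_pos_iff_exists_adj v).2 (F.exists_adj v)
  omega

/-- If there is only one support vertex, it is the only vertex that is not a leaf. -/
lemma eq_of_degree_ne_one (F : LeafFrame T) {s : V} (hs : ∀ t ∈ supports T, t = s) {x : V}
    (hx : T.degree x ≠ 1) : x = s := by
  by_cases hxr : T.Adj F.r x
  · exact hs x (mem_supports.2 ⟨F.r, hxr.symm, F.degree_r⟩)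
  · obtain ⟨t, ht, hxt⟩ := exists_support_anc F.isTree (F.ne_root hx) hx
    obtain ⟨t', ht', h⟩ := F.exists_support_not_anc
    refine absurd hxt ?_
    rw [hs t ht, ← hs t' ht']
    exact h x (F.ne_root hx) hxr

/-- The upper bound for trees with a leaf frame. If there is a single support vertex, the tree is
a star, whose centre gets a path of its own. -/
lemma spathC_le : ∃ k, 3 * k ≤ 2 * (leaves T).card + 2 ∧
    spathC T (vertexElems T) ≤ k + (F.gaps.card / 2 + 1) := by
  classical
  have hT := F.isTree
  obtain ⟨Q, hbase, hQ, hcov, hsep⟩ := F.exists_leafPairs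
  refine ⟨Q.card, hQ, ?_⟩
  by_cases hbig : ∀ s, ∃ t ∈ supports T, t ≠ s
  · obtain ⟨Q', hQ', hsep'⟩ := F.exists_pairs_separating_chains
    refine (spathC_le_card hT (Q ∪ Q') ?_ ?_).trans ((Finset.card_union_le Q Q').trans
      (Nat.add_le_add_left hQ' _))
    · have hin : ∀ {x y : V}, (∃ q ∈ F.basePairs, OnPath T q.1 q.2 x ∧ ¬ OnPath T q.1 q.2 y) →
          ∃ q ∈ Q ∪ Q', (OnPath T q.1 q.2 x ∧ ¬ OnPath T q.1 q.2 y) ∨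
            (¬ OnPath T q.1 q.2 x ∧ OnPath T q.1 q.2 y) := fun ⟨q, hq, h⟩ =>
        ⟨q, Finset.mem_union_left _ (hbase hq), Or.inl h⟩
      have hswap : ∀ {x y : V}, (∃ q ∈ Q ∪ Q', (OnPath T q.1 q.2 x ∧ ¬ OnPath T q.1 q.2 y) ∨
            (¬ OnPath T q.1 q.2 x ∧ OnPath T q.1 q.2 y)) →
          ∃ q ∈ Q ∪ Q', (OnPath T q.1 q.2 y ∧ ¬ OnPath T q.1 q.2 x) ∨
            (¬ OnPath T q.1 q.2 y ∧ OnPath T q.1 q.2 x) := fun ⟨q, hq, h⟩ =>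
        ⟨q, hq, by tauto⟩
      intro x y hxy
      rcases F.degree_cases x with hx | hx | hx
      · rcases F.degree_cases y with hy | hy | hy
        · obtain ⟨q, hq, h⟩ := hsep x y hx hy hxy
          exact ⟨q, Finset.mem_union_left _ hq, h⟩
        · exact hswap (hin (F.separates_leaf_degree_two hx hy))
        · exact hswap (hin (F.separates_three_le hbig hy hxy))
      · rcases F.degree_cases y with hy | hy | hy
        · exact hin (F.separates_leaf_degree_two hy hx)
        · by_cases hc : F.Chain x y
          · obtain ⟨q, hq, h⟩ := hsep' x y hxy hc
            exact ⟨q, Finset.mem_union_right _ hq, h⟩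
          by_cases hc' : F.Chain y x
          · obtain ⟨q, hq, h⟩ := hsep' y x hxy.symm hc'
            exact hswap ⟨q, Finset.mem_union_right _ hq, h⟩
          obtain ⟨q, hq, h⟩ := F.separates_degree_two hx hy hxy hc hc'
          exact ⟨q, Finset.mem_union_left _ (hbase hq), h⟩
        · exact hswap (hin (F.separates_three_le hbig hy hxy))
      · exact hin (F.separates_three_le hbig hx hxy.symm)
    · intro x
      rcases F.degree_cases x with hx | hx | hx
      · obtain ⟨q, hq, h⟩ := hcov x hx
        exact ⟨q, Finset.mem_union_left _ hq, h⟩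
      · obtain ⟨i, -, -, -, h, -⟩ := F.exists_links_of_degree_two hx
        exact ⟨_, Finset.mem_union_left _ (hbase (F.link_mem i)), h⟩
      · obtain ⟨y, hy⟩ := F.exists_adj x
        obtain ⟨q, hq, h, -⟩ := F.separates_three_le hbig hx hy.ne'
        exact ⟨q, Finset.mem_union_left _ (hbase hq), h⟩
  · push Not at hbig
    obtain ⟨s, hs⟩ := hbig
    have hcentre : ∀ w, OnPath T s s w ↔ w = s := fun w => by
      rw [onPath_iff hT (p := Walk.nil) Walk.IsPath.nil]
      simp
    have hin : (s, s) ∈ insert (s, s) Q := Finset.mem_insert_self _ _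
    refine (spathC_le_card hT (insert (s, s) Q) ?_ ?_).trans ((Finset.card_insert_le _ _).trans
      (by omega))
    · intro x y hxy
      by_cases hx : T.degree x = 1
      · by_cases hy : T.degree y = 1
        · obtain ⟨q, hq, h⟩ := hsep x y hx hy hxy
          exact ⟨q, Finset.mem_insert_of_mem hq, h⟩
        · have := F.eq_of_degree_ne_one hs hy
          refine ⟨_, hin, Or.inr ?_⟩
          rw [hcentre, hcentre]
          exact ⟨fun h => hxy (h.trans this.symm), this⟩
      · have := F.eq_of_degree_ne_one hs hx
        refine ⟨_, hin, Or.inl ?_⟩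
        rw [hcentre, hcentre]
        exact ⟨this, fun h => hxy (this.trans h.symm)⟩
    · intro x
      by_cases hx : T.degree x = 1
      · obtain ⟨q, hq, h⟩ := hcov x hx
        exact ⟨q, Finset.mem_insert_of_mem hq, h⟩
      · exact ⟨_, hin, (hcentre x).2 (F.eq_of_degree_ne_one hs hx)⟩

end LeafFrame

/-- If all bunches have size at least three, then every support vertex has three leaves: its
bunch is contained in the star formed by the vertex and its leaves. -/
lemma three_le_card_leaf_neighbors
    (hb : ∀ c : (leafGraph T).ConnectedComponent, IsBunch T c → 3 ≤ bunchSize T c) {s : V}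
    (hs : s ∈ supports T) : 3 ≤ ((T.neighborFinset s).filter fun l => T.degree l = 1).card := by
  classical
  obtain ⟨l, hsl, hl⟩ := mem_supports.1 hs
  set N := (T.neighborFinset s).filter fun l => T.degree l = 1 with hN
  have hmemN : ∀ w, w ∈ N ↔ T.Adj s w ∧ T.degree w = 1 := fun w => by simp [hN]
  have hadj : ∀ x y, (leafGraph T).Adj x y ↔ T.Adj x y ∧ (T.degree x = 1 ∨ T.degree y = 1) := by
    intro x y
    simp only [leafGraph, deleteEdges_adj, interiorEdges, Set.mem_sep_iff, mem_edgeSet,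
      Sym2.mem_iff, forall_eq_or_imp, forall_eq]
    tauto
  have hclosed : ∀ x y, (leafGraph T).Adj x y → x ∈ insert s N → y ∈ insert s N := by
    intro x y hxy hx
    rw [hadj] at hxy
    rw [Finset.mem_insert, hmemN] at hx ⊢
    rcases hx with rfl | ⟨hsx, hx⟩
    · rcases hxy.2 with h | h
      · right
        rw [eq_of_adj_leaf h hxy.1.symm hsl.symm]
        exact ⟨hsl, hl⟩
      · exact Or.inr ⟨hxy.1, h⟩
    · exact Or.inl (eq_of_adj_leaf hx hxy.1.symm hsx)
  let c := (leafGraph T).connectedComponentMk s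
  have hsupp : ∀ w ∈ c.supp, w ∈ insert s N := by
    intro w hw
    rw [ConnectedComponent.mem_supp_iff, ConnectedComponent.eq] at hw
    obtain ⟨p⟩ := hw.symm
    by_contra hwN
    obtain ⟨d, -, h1, h2⟩ := p.exists_boundary_dart {w | w ∈ insert s N}
      (Finset.mem_insert_self _ _) hwN
    exact h2 (hclosed _ _ d.adj h1)
  have hbunch : IsBunch T c := by
    refine ⟨s, rfl, l, ?_, hsl.ne⟩
    rw [ConnectedComponent.mem_supp_iff, ConnectedComponent.eq]
    exact ((hadj s l).2 ⟨hsl, Or.inr hl⟩).reachable.symm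
  have hsize := hb c hbunch
  by_cases hsd : T.degree s = 1
  · have h1 : {v ∈ c.supp | T.degree v = 1} ⊆ ((insert s N : Finset V) : Set V) :=
      fun v hv => hsupp v hv.1
    have h2 := Set.ncard_le_ncard h1 (Set.toFinite _)
    rw [Set.ncard_coe_finset] at h2
    have h3 := Finset.card_insert_le s N
    have h4 : N.card ≤ (T.neighborFinset s).card := Finset.card_filter_le _ _
    rw [card_neighborFinset_eq_degree, hsd] at h4
    rw [bunchSize] at hsize
    omega
  · have h1 : {v ∈ c.supp | T.degree v = 1} ⊆ (N : Set V) := by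
      rintro v ⟨hv, hv1⟩
      refine (Finset.mem_insert.1 (hsupp v hv)).resolve_left ?_
      rintro rfl
      exact hsd hv1
    have h2 := Set.ncard_le_ncard h1 (Set.toFinite _)
    rw [Set.ncard_coe_finset] at h2
    exact hsize.trans h2

/-- The upper bound in integers. -/
lemma exists_upper_bound (hT : T.IsTree)
    (hb : ∀ c : (leafGraph T).ConnectedComponent, IsBunch T c → 3 ≤ bunchSize T c) :
    ∃ k m, 3 * k ≤ 2 * h1 T + 2 ∧ 2 * m ≤ h2star T + 2 ∧ spathC T (vertexElems T) ≤ k + m := by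
  classical
  rcases subsingleton_or_nontrivial V with hV | hV
  · obtain ⟨v⟩ := hT.connected.nonempty
    refine ⟨0, 1, by omega, by omega, ?_⟩
    have := spathC_le_card hT {(v, v)} (fun x y hxy => absurd (Subsingleton.elim x y) hxy)
      (fun x => ⟨(v, v), by simp, by rw [Subsingleton.elim x v]; exact onPath_left hT v v⟩)
    simpa using this
  · obtain ⟨F⟩ := exists_leafFrame hT fun s hs => three_le_card_leaf_neighbors hb hs
    obtain ⟨k, hk, hle⟩ := F.spathC_le
    refine ⟨k, F.gaps.card / 2 + 1, by rwa [h1_eq_card_leaves], ?_, hle⟩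
    have h1 := F.card_gaps_le
    have h2 := card_midEdges_le_h2star hT
    omega

end UpperBound

end PathSeparation

theorem theorem2 {V : Type*} [Fintype V] (T : SimpleGraph V) [DecidableRel T.Adj]
    (hT : T.IsTree) :
    max ⌈(2 * (PathSeparation.h1 T : ℚ) + (PathSeparation.h2star T : ℚ)) / 3⌉
        ⌈((PathSeparation.h1 T : ℚ) + (PathSeparation.h2star T : ℚ)) / 2⌉
      ≤ (PathSeparation.spathC T (PathSeparation.vertexElems T) : ℤ) ∧
    ((∀ c : (PathSeparation.leafGraph T).ConnectedComponent,
        PathSeparation.IsBunch T c → 3 ≤ PathSeparation.bunchSize T c) →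
      IsEmpty (T ≃g completeBipartiteGraph (Fin 1) (Fin 3)) →
      (PathSeparation.spathC T (PathSeparation.vertexElems T) : ℤ) ≤
        ⌈2 * (PathSeparation.h1 T : ℚ) / 3⌉ + ⌈((PathSeparation.h2star T : ℚ) + 1) / 2⌉) := by
  constructor
  · obtain ⟨F, hS, hC, hF⟩ :=
      PathSeparation.spathC_attained T (PathSeparation.vertexElems T)
    obtain ⟨h1, h2⟩ := PathSeparation.counting_bounds hS hC
    rw [hF] at h1 h2
    have h1' : ((PathSeparation.h1 T : ℚ) + PathSeparation.h2star T) ≤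
        2 * PathSeparation.spathC T (PathSeparation.vertexElems T) := by exact_mod_cast h1
    have h2' : (2 * (PathSeparation.h1 T : ℚ) + PathSeparation.h2star T) ≤
        3 * PathSeparation.spathC T (PathSeparation.vertexElems T) := by exact_mod_cast h2
    refine max_le (Int.ceil_le.2 ?_) (Int.ceil_le.2 ?_)
    · push_cast
      linarith
    · push_cast
      linarith
  · intro hb _
    obtain ⟨k, m, hk, hm, hle⟩ := PathSeparation.exists_upper_bound hT hb
    have hk' : (3 * k : ℚ) ≤ 2 * PathSeparation.h1 T + 2 := by exact_mod_cast hk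
    have hm' : (2 * m : ℚ) ≤ PathSeparation.h2star T + 2 := by exact_mod_cast hm
    have h1 : (k : ℤ) ≤ ⌈2 * (PathSeparation.h1 T : ℚ) / 3⌉ := by
      refine Int.sub_one_lt_iff.1 (Int.lt_ceil.2 ?_)
      push_cast
      linarith
    have h2 : (m : ℤ) ≤ ⌈((PathSeparation.h2star T : ℚ) + 1) / 2⌉ := by
      refine Int.sub_one_lt_iff.1 (Int.lt_ceil.2 ?_)
      push_cast
      linarith
    have h3 : (PathSeparation.spathC T (PathSeparation.vertexElems T) : ℤ) ≤ k + m := by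
      exact_mod_cast hle
    linarith
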